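/- **Setting.** Let $q\in\mathbb C^*$ be not a root of unity, $v\in\mathbb C^*$, $\mu,\mu',\nu,\nu'\in\mathbb C$, and let $2s\in\mathbb Z_{\ge 0}$. Put $[X,Y]_q=qXY-q^{-1}YX$ and $$\rho=-\tfrac14q^{\nu+\nu'}(q^2-q^{-2})^2,\qquad \omega=\tfrac14q^{\nu+\nu'}(q-q^{-1})^2\big((v^2+v^{-2})(q^{2s+1}+q^{-2s-1})-4\cosh\mu\cosh\mu'\big),$$ $$\eta=-\tfrac14q^{\frac32(\nu+\nu')}\tfrac{(q^2-q^{-2})^2}{q+q^{-1}}\big(\cosh\mu\,(v^2+v^{-2})-\cosh\mu'\,(q^{2s+1}+q^{-2s-1})\big),$$ and let $\eta^*$ be obtained from $\eta$ by exchanging $\mu$ and $\mu'$. The Askey–Wilson algebra $AW$ is generated by $A,A^*$ with relations $[A,[A,A^*]_q]_{q^{-1}}=\rho A^*+\omega A+\eta$ and $[A^*,[A^*,A]_q]_{q^{-1}}=\rho A+\omega A^*+\eta^*$; let $I(\kappa,\kappa^*,0,0)=\kappa A+\kappa^*A^*$ for $\kappa,\kappa^*\in\mathbb C$. With $T_\pm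 f(z)=f(q^{\pm2}z)$ and $$\phi(z)=\tfrac12q^{\frac{\nu+\nu'}2}e^{-\mu'}q^{2s}\,\frac{(1+qe^{-\mu+\mu'}z)(1+qe^{\mu+\mu'}z)(1-q^{-2s}v^2z)(1-q^{-2s}v^{-2}z)}{(1-z^2)(1-q^2z^2)},$$ $AW$ is represented on $\mathbb C(z)$ by $$\pi(A)=q^{-1}z^{-1}\phi(z)(T_+-1)+q^{-1}z\,\phi(z^{-1})(T_--1)+\tfrac12q^{\frac{\nu+\nu'}2}e^{-\mu'}q^{2s}\big(2e^{\mu'}\cosh\mu-(v^2+v^{-2})q^{-2s-1}+q^{-1}(z+z^{-1})\big),$$ $$\pi(A^*)=\phi(z)(T_+-1)+\phi(z^{-1})(T_--1)+\tfrac12q^{\frac{\nu+\nu'}2}\big(e^{\mu'}q^{-2s}+e^{-\mu'}q^{2s}\big).$$ Put $Z=\frac{z+z^{-1}}{q+q^{-1}}$, $X_k=\frac{q^{2k-2s}v^2+q^{2s-2k}v^{-2}}{q+q^{-1}}$, $\delta_d=-\frac{(-1)^{2s+1}}2e^{-\mu'}q^{\frac{\nu+\nu'}2-(2s+2)}$,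 $[n]_q=\frac{q^n-q^{-n}}{q-q^{-1}}$ and $$H(U)=(q+q^{-1})^{2s+1}\sum_{k=0}^{2s+1}(-1)^k\mathsf e_k(X_0,\dots,X_{2s})\,U^{2s+1-k},$$ where $\mathsf e_k$ are the elementary symmetric polynomials. **Bethe equations.** Let $b(x)=x-x^{-1}$ and $$F(u)=e^{-\mu'}q^{-(2s+1)}(q^{2s+1}uv^{-1}-u^{-1}v)(q^{2s+1}uv-u^{-1}v^{-1})(u+e^{\mu+\mu'}u^{-1})(u+e^{\mu'-\mu}u^{-1}),$$ $\Delta_{sp}(u)=1$, $\Delta_d(u)=u(\kappa u+\kappa^*u^{-1})$, $\bar\Delta_{sp}=0$, $\bar\Delta_d=-2(-1)^{2s}\frac{q^{-(\nu+\nu')/2+1}}{q-q^{-1}}\kappa\,\delta_d$. For $a\in\{sp,d\}$ and $U=\frac{qu^2+q^{-1}u^{-2}}{q+q^{-1}}$, let $g_0^{(N)}$ ($N$ even), $g_a^{(even)}$, $g_a^{(odd)}$ be the polynomials with $g_0^{(N)}(U)=b(qu^2)^N$, $$g_a^{(even)}(U)=\frac{\Delta_a(q^{-1}u^{-1})F(q^{-1}u^{-1})-\Delta_a(u)F(u)}{b(qu^2)},\qquad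 g_a^{(odd)}(U)=\Delta_a(u)F(u)+\Delta_a(q^{-1}u^{-1})F(q^{-1}u^{-1}).$$ For $U_1,\dots,U_M\in\mathbb C$ and $\bar U_i=\{U_j\}_{j\ne i}$ put $$P_a^M(U_i,\bar U_i)=\sum_{k=0}^{M-1}\frac{(-1)^k(q+q^{-1})^{M-1}}{2^{M-1-k}}\mathsf e_k(\bar U_i)\sum_{l=0}^{M-1-k}\binom{M-1-k}{l}(q-q^{-1})^l\big((q^2+q^{-2})U_i\big)^{M-1-k-l}g_0^{(2\lfloor l/2\rfloor)}(U_i)\,g_a^{(p[l])}(U_i)+\bar\Delta_aH(U_i),$$ where $p[l]$ is the parity of $l$. An admissible solution for $a$ is a family of pairwise distinct $U_1,\dots,U_M$ with $P_a^M(U_i,\bar U_i)=0$ for $i=1,\dots,M$, and its Q-polynomial is $\prod_{j=1}^M(Z-U_j)$. **Lemma.** Let $M\ge 0$. 1. For every admissible solution $U_1,\dots,U_M$ for $a=sp$, its Q-polynomial $Q_M(Z)$ is nonzero and $$\pi(I(0,\kappa^*,0,0))\,Q_M(Z)=\tfrac{\kappa^*}2q^{\frac{\nu+\nu'}2}\big(e^{-\mu'}q^{2s-2M}+e^{\mu'}q^{-2s+2M}\big)\,Q_M(Z).$$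 2. For every admissible solution $U_1,\dots,U_{2s}$ for $a=d$ with $\kappa^*=0$ and $M=2s$, with Q-polynomial $\bar Q_{2s}(Z)$, $$\pi(I(\kappa,0,0,0))\,\bar Q_{2s}(Z)=\Lambda\,\bar Q_{2s}(Z)-\kappa q\,\delta_d\frac{(-1)^{2s+1}}{(q+q^{-1})^{2s}}H(Z),$$ $$\Lambda=\tfrac\kappa2q^{\frac{\nu+\nu'}2}e^{-\mu'}q^{-2s}\Big((v^2+v^{-2})[2s]_q+2e^{\mu'}\cosh\mu-(1+q^2)\sum_{i=1}^{2s}U_i\Big).$$ 3. For every admissible solution $U_1,\dots,U_{2s}$ for $a=d$ with $M=2s$, with Q-polynomial $\tilde Q_{2s}(Z)$, $$\pi(I(\kappa,\kappa^*,0,0))\,\tilde Q_{2s}(Z)=\Lambda_d\,\tilde Q_{2s}(Z)-\kappa q\,\delta_d\frac{(-1)^{2s+1}}{(q+q^{-1})^{2s}}H(Z),$$ where $\Lambda_d=\tfrac{\kappa^*}2q^{\frac{\nu+\nu'}2}\big(e^{-\mu'}q^{-2s}+e^{\mu'}q^{2s}\big)+\Lambda$ with $\Lambda$ given by the formula in part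 2 for the present $U_i$. -/

import Mathlib

namespace HeunAW

noncomputable section

/-- The scalars of the setting: `q` is nonzero and not a root of unity, `v` is nonzero,
`mu, muP, nu, nuP` are arbitrary complex numbers, and `twoS` is the natural number `2s`
(`s` an integer or half-integer). -/
structure Params where
  q : ℂ
  mu : ℂ
  muP : ℂ
  nu : ℂ
  nuP : ℂ
  v : ℂ
  twoS : ℕ
  q_ne_zero : q ≠ 0
  q_pow_ne_one : ∀ k : ℕ, 0 < k → q ^ k ≠ 1
  v_ne_zero : v ≠ 0

/-- The scalar `q ^ ((ν + ν') / 2)`. -/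
def Params.qNu (P : Params) : ℂ := P.q ^ ((P.nu + P.nuP) / 2)

/-- The scalar `χ`. -/
def Params.chi (P : Params) : ℂ := -(1 / 2) * P.q ^ P.nu * (P.q ^ 2 - (P.q ^ 2)⁻¹)

/-- The structure constant `ρ`. -/
def Params.rho (P : Params) : ℂ :=
  -(1 / 4) * P.q ^ (P.nu + P.nuP) * (P.q ^ 2 - (P.q ^ 2)⁻¹) ^ 2

/-- The structure constant `ω`. -/
def Params.omega (P : Params) : ℂ :=
  1 / 4 * P.q ^ (P.nu + P.nuP) * (P.q - P.q⁻¹) ^ 2 *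
    ((P.v ^ 2 + (P.v ^ 2)⁻¹) * (P.q ^ (P.twoS + 1) + (P.q ^ (P.twoS + 1))⁻¹)
      - 4 * Complex.cosh P.mu * Complex.cosh P.muP)

/-- The structure constant `η`. -/
def Params.eta (P : Params) : ℂ :=
  -(1 / 4) * P.q ^ (3 / 2 * (P.nu + P.nuP)) * ((P.q ^ 2 - (P.q ^ 2)⁻¹) ^ 2 / (P.q + P.q⁻¹)) *
    (Complex.cosh P.mu * (P.v ^ 2 + (P.v ^ 2)⁻¹)
      - Complex.cosh P.muP * (P.q ^ (P.twoS + 1) + (P.q ^ (P.twoS + 1))⁻¹))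

/-- The structure constant `η*`. -/
def Params.etaStar (P : Params) : ℂ :=
  -(1 / 4) * P.q ^ (3 / 2 * (P.nu + P.nuP)) * ((P.q ^ 2 - (P.q ^ 2)⁻¹) ^ 2 / (P.q + P.q⁻¹)) *
    (Complex.cosh P.muP * (P.v ^ 2 + (P.v ^ 2)⁻¹)
      - Complex.cosh P.mu * (P.q ^ (P.twoS + 1) + (P.q ^ (P.twoS + 1))⁻¹))

/-! ### The Askey-Wilson algebra and the Heun-Askey-Wilson element -/

/-- The `q`-commutator `[x, y]_q = q x y - q⁻¹ y x`. -/
def qComm {R : Type*} [Ring R] [Algebra ℂ R] (q : ℂ) (x y : R) : R :=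
  q • (x * y) - q⁻¹ • (y * x)

/-- The two Askey-Wilson relations in the free algebra on `A = ι 0` and `A* = ι 1`. -/
inductive AWRel (P : Params) : FreeAlgebra ℂ (Fin 2) → FreeAlgebra ℂ (Fin 2) → Prop
  | rel₁ : AWRel P
      (qComm P.q⁻¹ (FreeAlgebra.ι ℂ 0) (qComm P.q (FreeAlgebra.ι ℂ 0) (FreeAlgebra.ι ℂ 1)))
      (P.rho • FreeAlgebra.ι ℂ 1 + P.omega • FreeAlgebra.ι ℂ 0 + P.eta • 1)
  | rel₂ : AWRel P
      (qComm P.q⁻¹ (FreeAlgebra.ι ℂ 1) (qComm P.q (FreeAlgebra.ι ℂ 1) (FreeAlgebra.ι ℂ 0)))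
      (P.rho • FreeAlgebra.ι ℂ 0 + P.omega • FreeAlgebra.ι ℂ 1 + P.etaStar • 1)

/-- The Askey-Wilson algebra with structure constants `ρ, ω, η, η*`. -/
abbrev AWAlgebra (P : Params) : Type := RingQuot (AWRel P)

/-- The generator `A` of the Askey-Wilson algebra. -/
def genA (P : Params) : AWAlgebra P := RingQuot.mkAlgHom ℂ (AWRel P) (FreeAlgebra.ι ℂ 0)

/-- The generator `A*` of the Askey-Wilson algebra. -/
def genAStar (P : Params) : AWAlgebra P := RingQuot.mkAlgHom ℂ (AWRel P) (FreeAlgebra.ι ℂ 1)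

/-- The Heun-Askey-Wilson element `I(κ, κ*, κ₊, κ₋)`. -/
def heunAW (P : Params) (κ κs κp κm : ℂ) : AWAlgebra P :=
  κ • genA P + κs • genAStar P + (κp * P.chi⁻¹) • qComm P.q (genA P) (genAStar P)
    + (κm * P.chi) • qComm P.q (genAStar P) (genA P)

/-! ### The realization by `q`-difference operators on the field `ℂ(z)` -/

theorem scale_nonZeroDivisors (c : ℂ) (hc : c ≠ 0) :
    nonZeroDivisors (Polynomial ℂ) ≤ (nonZeroDivisors (Polynomial ℂ)).comap
      (Polynomial.aeval (Polynomial.C c * Polynomial.X) : Polynomial ℂ →ₐ[ℂ] Polynomial ℂ) := by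
  intro p hp
  rw [Submonoid.mem_comap, mem_nonZeroDivisors_iff_ne_zero]
  rw [mem_nonZeroDivisors_iff_ne_zero] at hp
  intro h
  apply hp
  have h' : p.comp (Polynomial.C c * Polynomial.X) = 0 := by
    rwa [Polynomial.comp_eq_aeval]
  ext k
  have := congrArg (fun r : Polynomial ℂ => r.coeff k) h'
  simpa [Polynomial.comp_C_mul_X_coeff, hc] using this

/-- The substitution `f(z) ↦ f(c z)` on `ℂ(z)`, for `c ≠ 0`. -/
def scale (c : ℂ) (hc : c ≠ 0) : RatFunc ℂ →ₐ[ℂ] RatFunc ℂ :=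
  RatFunc.mapAlgHom (Polynomial.aeval (Polynomial.C c * Polynomial.X))
    (scale_nonZeroDivisors c hc)

/-- `T₊ f(z) = f(q² z)`. -/
def Tplus (P : Params) : RatFunc ℂ →ₐ[ℂ] RatFunc ℂ :=
  scale (P.q ^ 2) (pow_ne_zero 2 P.q_ne_zero)

/-- `T₋ f(z) = f(q⁻² z)`. -/
def Tminus (P : Params) : RatFunc ℂ →ₐ[ℂ] RatFunc ℂ :=
  scale (P.q ^ 2)⁻¹ (inv_ne_zero (pow_ne_zero 2 P.q_ne_zero))

/-- The rational function `φ`, evaluated at the element `t` of `ℂ(z)`. -/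
def phi (P : Params) (t : RatFunc ℂ) : RatFunc ℂ :=
  RatFunc.C (1 / 2 * P.qNu * Complex.exp (-P.muP) * P.q ^ P.twoS) *
    ((1 + RatFunc.C (P.q * Complex.exp (-P.mu + P.muP)) * t)
      * (1 + RatFunc.C (P.q * Complex.exp (P.mu + P.muP)) * t)
      * (1 - RatFunc.C ((P.q ^ P.twoS)⁻¹ * P.v ^ 2) * t)
      * (1 - RatFunc.C ((P.q ^ P.twoS)⁻¹ * (P.v ^ 2)⁻¹) * t))
    / ((1 - t ^ 2) * (1 - RatFunc.C (P.q ^ 2) * t ^ 2))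

/-- The multiplication term of the `q`-difference operator `π(A)`. -/
def multA (P : Params) : RatFunc ℂ :=
  RatFunc.C (1 / 2 * P.qNu * Complex.exp (-P.muP) * P.q ^ P.twoS) *
    (RatFunc.C (2 * Complex.exp P.muP * Complex.cosh P.mu
        - (P.v ^ 2 + (P.v ^ 2)⁻¹) * (P.q ^ (P.twoS + 1))⁻¹)
      + RatFunc.C P.q⁻¹ * (RatFunc.X + RatFunc.X⁻¹))

/-- The operator `π(A)`:
`q⁻¹ z⁻¹ φ(z) (T₊ - 1) + q⁻¹ z φ(z⁻¹) (T₋ - 1) + ` a multiplication operator. -/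
def opA (P : Params) : Module.End ℂ (RatFunc ℂ) :=
  LinearMap.mulLeft ℂ (RatFunc.C P.q⁻¹ * RatFunc.X⁻¹ * phi P RatFunc.X)
      * ((Tplus P).toLinearMap - 1)
    + LinearMap.mulLeft ℂ (RatFunc.C P.q⁻¹ * RatFunc.X * phi P RatFunc.X⁻¹)
      * ((Tminus P).toLinearMap - 1)
    + LinearMap.mulLeft ℂ (multA P)

/-- The operator `π(A*)`: `φ(z) (T₊ - 1) + φ(z⁻¹) (T₋ - 1) + ` a scalar. -/
def opAStar (P : Params) : Module.End ℂ (RatFunc ℂ) :=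
  LinearMap.mulLeft ℂ (phi P RatFunc.X) * ((Tplus P).toLinearMap - 1)
    + LinearMap.mulLeft ℂ (phi P RatFunc.X⁻¹) * ((Tminus P).toLinearMap - 1)
    + (1 / 2 * P.qNu * (Complex.exp P.muP * (P.q ^ P.twoS)⁻¹
        + Complex.exp (-P.muP) * P.q ^ P.twoS)) • 1

def phiK {K : Type*} [Field K] (N q E m y v t : K) : K :=
  N / 2 * E⁻¹ * y * ((1 + q * (m⁻¹ * E) * t) * (1 + q * (m * E) * t) * (1 - y⁻¹ * v ^ 2 * t) *
    (1 - y⁻¹ * (v ^ 2)⁻¹ * t)) / ((1 - t ^ 2) * (1 - q ^ 2 * t ^ 2))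
def cK {K : Type*} [Field K] (N q E m y v t : K) : K :=
  N / 2 * E⁻¹ * y * (E * (m + m⁻¹) - (v ^ 2 + (v ^ 2)⁻¹) * (y⁻¹ * q⁻¹) + q⁻¹ * (t + t⁻¹))
def kK {K : Type*} [Field K] (N E y : K) : K := N / 2 * (E * y⁻¹ + E⁻¹ * y)

theorem id1 {K : Type*} [Field K] [CharZero K] (N q E m y v z : K) (hq : q ≠ 0) (hE : E ≠ 0)
    (hm : m ≠ 0) (hy : y ≠ 0) (hv : v ≠ 0) (hz : z ≠ 0) (h1 : 1 - z ^ 2 ≠ 0)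
    (h2 : 1 - q ^ 2 * z ^ 2 ≠ 0) (h3 : 1 - q ^ 4 * z ^ 2 ≠ 0) (h4 : z ^ 2 - q ^ 2 ≠ 0) :
    (q ^ 2 * z - (q ^ 2 * z)⁻¹) * phiK N q E m y v (q ^ 2 * z)⁻¹ =
    q * cK N q E m y v (q ^ 2 * z) - q⁻¹ * cK N q E m y v z + kK N E y * z⁻¹ * (1 - (q ^ 2)⁻¹)
      + ((q ^ 2)⁻¹ - 1) * z⁻¹ * phiK N q E m y v z
      + (z * (q ^ 2)⁻¹ - z⁻¹) * phiK N q E m y v z⁻¹ := by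
  have e1 : (q ^ 2 * z - (q ^ 2 * z)⁻¹) * phiK N q E m y v (q ^ 2 * z)⁻¹ =
    - (N / 2 * E⁻¹ * y * ((q ^ 2 * z  + q * (m⁻¹ * E)) * (q ^ 2 * z + q * (m * E)) * (q ^ 2 * z - y⁻¹ * v ^ 2) *
    (q ^ 2 * z - y⁻¹ * (v ^ 2)⁻¹)) / ((q ^ 2 * z) * (1 - q ^ 2 * z ^ 2) * q ^ 2)) := by
    have a1 : 1 - (q^2 * z)⁻¹ ^ 2 = -(1 - q ^ 4 * z ^ 2) / (q^4 * z^2) := by field_simp; ring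
    have a2 : 1 - q ^ 2 * (q^2 * z)⁻¹ ^ 2 = -(1 - q ^ 2 * z ^ 2) / (q^2 * z^2) := by field_simp; ring
    have a3 : q^2 * z - (q ^ 2 * z)⁻¹ = -(1 - q ^ 4 * z ^ 2) / (q ^ 2 * z) := by field_simp; ring
    unfold phiK
    rw [a1, a2, a3]
    field_simp
  have e2 : (z * (q ^ 2)⁻¹ - z⁻¹) * phiK N q E m y v z⁻¹ =
    (N / 2 * E⁻¹ * y * ((z  + q * (m⁻¹ * E)) * (z + q * (m * E)) * (z - y⁻¹ * v ^ 2) *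
    (z - y⁻¹ * (v ^ 2)⁻¹)) / (z * (z ^ 2 - 1) * q ^ 2)) := by
    have a1 : 1 - z⁻¹ ^ 2 = -(1 - z ^ 2) / (z^2) := by field_simp; ring
    have a2 : 1 - q ^ 2 * z⁻¹ ^ 2 = (z ^ 2 - q ^ 2) / (z^2) := by field_simp
    have a3 : z * (q ^ 2)⁻¹ - z⁻¹ = (z ^ 2 - q ^ 2) / (q ^ 2 * z) := by field_simp
    have a4 : z ^ 2 - 1 ≠ 0 := by intro h; apply h1; linear_combination -h
    unfold phiK
    rw [a1, a2, a3]
    field_simp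
    ring
  have a4 : z ^ 2 - 1 = -(1 - z ^ 2) := by ring
  rw [e1, e2, a4]
  unfold phiK cK kK
  field_simp
  ring

theorem id2 {K : Type*} [Field K] [CharZero K] (N q E m y v z : K) (hq : q ≠ 0) (hE : E ≠ 0)
    (hm : m ≠ 0) (hy : y ≠ 0) (hv : v ≠ 0) (hz : z ≠ 0) (h1 : 1 - z ^ 2 ≠ 0)
    (h2 : 1 - q ^ 2 * z ^ 2 ≠ 0) (h4 : z ^ 2 - q ^ 2 ≠ 0) :
    q * (cK N q E m y v (q ^ 2 * z) - cK N q E m y v z) * phiK N q E m y v z +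
    q * (cK N q E m y v ((q ^ 2)⁻¹ * z) - cK N q E m y v z) * phiK N q E m y v z⁻¹ +
    (q - q⁻¹) * kK N E y * cK N q E m y v z =
    N ^ 2 * (q - q⁻¹) / 4 * ((q + q⁻¹) * (z + z⁻¹) - (y * q + y⁻¹ * q⁻¹) * (v ^ 2 + (v ^ 2)⁻¹)
      + (m + m⁻¹) * (E + E⁻¹)) := by
  have b1 : q * (cK N q E m y v (q ^ 2 * z) - cK N q E m y v z) = - N / 2 * E⁻¹ * y * (q^2-1) * (1 - q^2*z^2) / (q^2 * z) := by
    unfold cK; field_simp; ring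
  have b2 : q * (cK N q E m y v ((q ^ 2)⁻¹ * z) - cK N q E m y v z) = - N / 2 * E⁻¹ * y * (q^2-1) * (z^2 - q^2) / (q^2 * z) := by
    unfold cK; field_simp; ring
  have e2 : (z ^ 2 - q^2) * phiK N q E m y v z⁻¹ =
    - (N / 2 * E⁻¹ * y * ((z  + q * (m⁻¹ * E)) * (z + q * (m * E)) * (z - y⁻¹ * v ^ 2) *
    (z - y⁻¹ * (v ^ 2)⁻¹)) / (1 - z ^ 2)) := by
    have a1 : 1 - z⁻¹ ^ 2 = -(1 - z ^ 2) / (z^2) := by field_simp; ring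
    have a2 : 1 - q ^ 2 * z⁻¹ ^ 2 = (z ^ 2 - q ^ 2) / (z^2) := by field_simp
    unfold phiK
    rw [a1, a2]
    field_simp
  have e1 : (1 - q^2*z^2) * phiK N q E m y v z =  (N / 2 * E⁻¹ * y * ((1 + q * (m⁻¹ * E) * z) * (1 + q * (m * E) * z) * (1 - y⁻¹ * v ^ 2 * z) *
    (1 - y⁻¹ * (v ^ 2)⁻¹ * z)) / (1 - z ^ 2)) := by
    unfold phiK; field_simp
  rw [b1, b2]
  have b3 : ∀ a x p w : K, a * x / w * p = a / w * (x * p) := by intros; ring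
  rw [b3 _ _ (phiK N q E m y v z), b3 _ _ (phiK N q E m y v z⁻¹), e1, e2]
  unfold cK kK
  field_simp
  ring

def xK {K : Type*} [Field K] (N q E m y v t : K) : K :=
  N ^ 2 * (q - q⁻¹) / 4 * ((q + q⁻¹) * (t + t⁻¹) - (y * q + y⁻¹ * q⁻¹) * (v ^ 2 + (v ^ 2)⁻¹)
      + (m + m⁻¹) * (E + E⁻¹))
def rhoK {K : Type*} [Field K] (N q : K) : K := -(1 / 4) * N ^ 2 * (q ^ 2 - (q ^ 2)⁻¹) ^ 2
def omK {K : Type*} [Field K] (N q E m y v : K) : K :=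
  1 / 4 * N ^ 2 * (q - q⁻¹) ^ 2 * ((v ^ 2 + (v ^ 2)⁻¹) * (y * q + y⁻¹ * q⁻¹)
      - (m + m⁻¹) * (E + E⁻¹))
def etaK {K : Type*} [Field K] (N q E m y v : K) : K :=
  -(1 / 4) * N ^ 3 * ((q ^ 2 - (q ^ 2)⁻¹) ^ 2 / (q + q⁻¹)) *
    ((m + m⁻¹) / 2 * (v ^ 2 + (v ^ 2)⁻¹) - (E + E⁻¹) / 2 * (y * q + y⁻¹ * q⁻¹))

theorem phi_mul₁ {K : Type*} [Field K] (N q E m y v z : K)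
    (h2 : 1 - q ^ 2 * z ^ 2 ≠ 0) :
    (1 - q ^ 2 * z ^ 2) * phiK N q E m y v z = (N / 2 * E⁻¹ * y * ((1 + q * (m⁻¹ * E) * z) *
      (1 + q * (m * E) * z) * (1 - y⁻¹ * v ^ 2 * z) *
      (1 - y⁻¹ * (v ^ 2)⁻¹ * z)) / (1 - z ^ 2)) := by
  unfold phiK; rw [mul_div_assoc', mul_comm (1 - z ^ 2), mul_div_mul_left _ _ h2]

theorem phi_mul₂ {K : Type*} [Field K] [CharZero K] (N q E m y v z : K) (hE : E ≠ 0)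
    (hm : m ≠ 0) (hy : y ≠ 0) (hv : v ≠ 0) (hz : z ≠ 0) (h1 : 1 - z ^ 2 ≠ 0)
    (h4 : z ^ 2 - q ^ 2 ≠ 0) :
    (z ^ 2 - q ^ 2) * phiK N q E m y v z⁻¹ =
    - (N / 2 * E⁻¹ * y * ((z  + q * (m⁻¹ * E)) * (z + q * (m * E)) * (z - y⁻¹ * v ^ 2) *
    (z - y⁻¹ * (v ^ 2)⁻¹)) / (1 - z ^ 2)) := by
  have a1 : 1 - z⁻¹ ^ 2 = -(1 - z ^ 2) / (z ^ 2) := by field_simp; ring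
  have a2 : 1 - q ^ 2 * z⁻¹ ^ 2 = (z ^ 2 - q ^ 2) / (z ^ 2) := by field_simp
  unfold phiK
  rw [a1, a2]
  field_simp

theorem id3 {K : Type*} [Field K] [CharZero K] (N q E m y v z : K) (hq : q ≠ 0) (hE : E ≠ 0)
    (hm : m ≠ 0) (hy : y ≠ 0) (hv : v ≠ 0) (hz : z ≠ 0) (h1 : 1 - z ^ 2 ≠ 0)
    (h2 : 1 - q ^ 2 * z ^ 2 ≠ 0) (h4 : z ^ 2 - q ^ 2 ≠ 0) (h5 : q ^ 2 + 1 ≠ 0) :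
    -z⁻¹ * (xK N q E m y v (q ^ 2 * z) - xK N q E m y v z) * phiK N q E m y v z
    - z * (xK N q E m y v ((q ^ 2)⁻¹ * z) - xK N q E m y v z) * phiK N q E m y v z⁻¹
    + (q⁻¹ - q) * xK N q E m y v z * cK N q E m y v z =
    rhoK N q * kK N E y + omK N q E m y v * cK N q E m y v z + etaK N q E m y v := by
  have b1 : -z⁻¹ * (xK N q E m y v (q ^ 2 * z) - xK N q E m y v z) =
      N ^ 2 * (q - q⁻¹) / 4 * (q + q⁻¹) * (q ^ 2 - 1) / (q ^ 2 * z ^ 2) * (1 - q ^ 2 * z ^ 2) := by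
    unfold xK; field_simp; ring
  have b2 : z * (xK N q E m y v ((q ^ 2)⁻¹ * z) - xK N q E m y v z) =
      - (N ^ 2 * (q - q⁻¹) / 4 * (q + q⁻¹) * (q ^ 2 - 1) / q ^ 2 * (z ^ 2 - q ^ 2)) := by
    unfold xK; field_simp; ring
  rw [b1, b2, neg_mul, mul_assoc _ (1 - q ^ 2 * z ^ 2), mul_assoc _ (z ^ 2 - q ^ 2),
    phi_mul₁ _ _ _ _ _ _ _ h2, phi_mul₂ _ _ _ _ _ _ _ hE hm hy hv hz h1 h4]
  have b3 : (q ^ 2 - (q ^ 2)⁻¹) ^ 2 / (q + q⁻¹) = (q ^ 2 - 1) ^ 2 * (q ^ 2 + 1) / q ^ 3 := by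
    have : q + q⁻¹ = (q ^ 2 + 1) / q := by field_simp
    rw [this]; field_simp; ring
  unfold etaK
  rw [b3]
  unfold xK rhoK kK omK cK
  field_simp
  ring

theorem id4 {K : Type*} [Field K] [CharZero K] (N q E m y v z : K) (hq : q ≠ 0) (hE : E ≠ 0)
    (hm : m ≠ 0) (hy : y ≠ 0) (hv : v ≠ 0) (hz : z ≠ 0) (h1 : 1 - z ^ 2 ≠ 0)
    (h2 : 1 - q ^ 2 * z ^ 2 ≠ 0) (h4 : z ^ 2 - q ^ 2 ≠ 0) (h5 : q ^ 2 + 1 ≠ 0) :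
    q⁻¹ * (xK N q E m y v (q ^ 2 * z) - xK N q E m y v z) * phiK N q E m y v z
    + q⁻¹ * (xK N q E m y v ((q ^ 2)⁻¹ * z) - xK N q E m y v z) * phiK N q E m y v z⁻¹
    + (q⁻¹ - q) * xK N q E m y v z * kK N E y =
    rhoK N q * cK N q E m y v z + omK N q E m y v * kK N E y + etaK N q m E y v := by
  have b1 : q⁻¹ * (xK N q E m y v (q ^ 2 * z) - xK N q E m y v z) =
      - (q⁻¹ * N ^ 2 * (q - q⁻¹) / 4 * (q + q⁻¹) * (q ^ 2 - 1) / (q ^ 2 * z)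
        * (1 - q ^ 2 * z ^ 2)) := by
    unfold xK; field_simp; ring
  have b2 : q⁻¹ * (xK N q E m y v ((q ^ 2)⁻¹ * z) - xK N q E m y v z) =
      - (q⁻¹ * N ^ 2 * (q - q⁻¹) / 4 * (q + q⁻¹) * (q ^ 2 - 1) / (q ^ 2 * z)
        * (z ^ 2 - q ^ 2)) := by
    unfold xK; field_simp; ring
  rw [b1, b2, neg_mul, neg_mul, mul_assoc _ (1 - q ^ 2 * z ^ 2), mul_assoc _ (z ^ 2 - q ^ 2),
    phi_mul₁ _ _ _ _ _ _ _ h2, phi_mul₂ _ _ _ _ _ _ _ hE hm hy hv hz h1 h4]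
  have b3 : (q ^ 2 - (q ^ 2)⁻¹) ^ 2 / (q + q⁻¹) = (q ^ 2 - 1) ^ 2 * (q ^ 2 + 1) / q ^ 3 := by
    have : q + q⁻¹ = (q ^ 2 + 1) / q := by field_simp
    rw [this]; field_simp; ring
  unfold etaK
  rw [b3]
  unfold xK rhoK kK omK cK
  field_simp
  ring

theorem xK_shift {K : Type*} [Field K] [CharZero K] (N q E m y v z : K) (hq : q ≠ 0) (hz : z ≠ 0) :
    q⁻¹ * xK N q E m y v (q ^ 2 * z) - q * xK N q E m y v z =
      rhoK N q * (q⁻¹ * z⁻¹) + omK N q E m y v ∧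
    q⁻¹ * xK N q E m y v z - q * xK N q E m y v (q ^ 2 * z) =
      rhoK N q * (q * z) + omK N q E m y v := by
  constructor
  all_goals
    unfold xK rhoK omK
    generalize (y * q + y⁻¹ * q⁻¹) = a
    generalize (v ^ 2 + (v ^ 2)⁻¹) = b
    generalize (m + m⁻¹) * (E + E⁻¹) = c
    field_simp
    ring

theorem xK_inv {K : Type*} [Field K] (N q E m y v z : K) :
    xK N q E m y v z⁻¹ = xK N q E m y v z := by
  unfold xK; rw [inv_inv, add_comm z⁻¹]

theorem cK_inv {K : Type*} [Field K] (N q E m y v z : K) :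
    cK N q E m y v z⁻¹ = cK N q E m y v z := by
  unfold cK; rw [inv_inv, add_comm z⁻¹]

/-! ### The operators satisfy the Askey-Wilson relations -/

theorem scale_X (c : ℂ) (hc : c ≠ 0) : scale c hc RatFunc.X = RatFunc.C c * RatFunc.X := by
  unfold scale
  rw [RatFunc.coe_mapAlgHom_eq_coe_map, ← RatFunc.algebraMap_X]
  have h := RatFunc.map_apply_div (Polynomial.aeval (Polynomial.C c * Polynomial.X) :
    Polynomial ℂ →ₐ[ℂ] Polynomial ℂ) (scale_nonZeroDivisors c hc) Polynomial.X 1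
  simpa using h

theorem scale_C (c : ℂ) (hc : c ≠ 0) (a : ℂ) : scale c hc (RatFunc.C a) = RatFunc.C a := by
  rw [← RatFunc.algebraMap_eq_C]
  exact (scale c hc).commutes a

theorem algHom_eq_of_X {f g : RatFunc ℂ →ₐ[ℂ] RatFunc ℂ} (h : f RatFunc.X = g RatFunc.X)
    (x : RatFunc ℂ) : f x = g x := by
  have hp : ∀ p : Polynomial ℂ, f (algebraMap _ _ p) = g (algebraMap _ _ p) := by
    intro p
    induction p using Polynomial.induction_on' with
    | add p r hp hr => simp only [map_add, hp, hr]
    | monomial k a =>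
      rw [← Polynomial.C_mul_X_pow_eq_monomial]
      simp only [map_mul, map_pow, RatFunc.algebraMap_X, RatFunc.algebraMap_C, h]
      rw [← RatFunc.algebraMap_eq_C, f.commutes, g.commutes]
  induction x using RatFunc.induction_on with
  | f p r hr => rw [map_div₀, map_div₀, hp, hp]

theorem Tplus_Tminus (P : Params) (x : RatFunc ℂ) : Tplus P (Tminus P x) = x := by
  have h := algHom_eq_of_X (f := (Tplus P).comp (Tminus P)) (g := AlgHom.id ℂ _) ?_ x
  · simpa using h
  · have hq : RatFunc.C (P.q ^ 2) ≠ 0 := by simp [P.q_ne_zero]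
    simp only [AlgHom.comp_apply, Tplus, Tminus, scale_X, map_mul, scale_C, AlgHom.id_apply]
    rw [map_inv₀, inv_mul_cancel_left₀ hq]

theorem Tminus_Tplus (P : Params) (x : RatFunc ℂ) : Tminus P (Tplus P x) = x := by
  have h := algHom_eq_of_X (f := (Tminus P).comp (Tplus P)) (g := AlgHom.id ℂ _) ?_ x
  · simpa using h
  · have hq : RatFunc.C (P.q ^ 2) ≠ 0 := by simp [P.q_ne_zero]
    simp only [AlgHom.comp_apply, Tplus, Tminus, scale_X, map_mul, scale_C, AlgHom.id_apply]
    rw [map_inv₀, mul_inv_cancel_left₀ hq]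


theorem quad_ne_zero (a b : ℂ) (ha : a ≠ 0) :
    RatFunc.C a + RatFunc.C b * RatFunc.X ^ 2 ≠ 0 := by
  intro h
  have h1 : algebraMap (Polynomial ℂ) (RatFunc ℂ)
      (Polynomial.C a + Polynomial.C b * Polynomial.X ^ 2) = 0 := by
    simpa [RatFunc.algebraMap_X] using h
  have h2 := (map_eq_zero_iff _ (RatFunc.algebraMap_injective ℂ)).1 h1
  have h3 := congrArg (fun p : Polynomial ℂ => p.coeff 0) h2
  simp at h3
  exact ha h3

/-- Abstract form of the computation of `[A*, A]_q` as a multiplication operator. -/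
theorem qcomm_mult {K : Type*} [Field K] (σ τ : K →+* K) (hστ : ∀ x, σ (τ x) = x)
    (hτσ : ∀ x, τ (σ x) = x) (q z k c φ ψ x : K) (hq : q ≠ 0) (hz : z ≠ 0)
    (hσq : σ q = q) (hτq : τ q = q) (hσz : σ z = q ^ 2 * z) (hτz : τ z = (q ^ 2)⁻¹ * z)
    (hσk : σ k = k) (hτk : τ k = k)
    (h1 : (q ^ 2 * z - (q ^ 2 * z)⁻¹) * σ ψ =
      q * σ c - q⁻¹ * c + k * z⁻¹ * (1 - (q ^ 2)⁻¹) + ((q ^ 2)⁻¹ - 1) * z⁻¹ * φ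
      + (z * (q ^ 2)⁻¹ - z⁻¹) * ψ)
    (h2 : (q ^ 2 * z⁻¹ - (q ^ 2 * z⁻¹)⁻¹) * τ φ =
      q * τ c - q⁻¹ * c + k * z * (1 - (q ^ 2)⁻¹) + ((q ^ 2)⁻¹ - 1) * z * ψ
      + (z⁻¹ * (q ^ 2)⁻¹ - z) * φ)
    (h3 : q * (σ c - c) * φ + q * (τ c - c) * ψ + (q - q⁻¹) * k * c = x)
    (A B : K → K)
    (hA : ∀ f, A f = q⁻¹ * z⁻¹ * φ * (σ f - f) + q⁻¹ * z * ψ * (τ f - f) + c * f)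
    (hB : ∀ f, B f = φ * (σ f - f) + ψ * (τ f - f) + k * f) (f : K) :
    q * B (A f) - q⁻¹ * A (B f) = x * f := by
  rw [hB (A f), hA (B f), hA f, hB f]
  simp only [map_add, map_sub, map_mul, map_inv₀, hστ, hτσ, hσq, hτq, hσz, hτz, hσk, hτk]
  subst h3
  generalize σ (σ f) = f2
  generalize τ (τ f) = f3
  generalize σ f = f0 at *
  generalize τ f = f1 at *
  generalize σ ψ = ψ1 at *
  generalize τ φ = φ1 at *
  generalize σ φ = φ2 at *
  generalize τ ψ = ψ2 at *
  generalize σ c = c0 at *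
  generalize τ c = c1 at *
  rw [← sub_eq_zero] at h1 h2 ⊢
  have h4 := congrArg (fun t => φ * (f - f0) * t) h1
  have h5 := congrArg (fun t => ψ * (f - f1) * t) h2
  simp only [mul_zero] at h4 h5
  rw [← add_zero (0 : K)]
  nth_rewrite 1 [← h4]
  rw [← h5]
  field_simp
  ring


section Bridge

variable (P : Params)

theorem qNu_ne : P.q ^ (P.nu + P.nuP) = P.qNu ^ 2 := by
  unfold Params.qNu
  rw [← Complex.cpow_nat_mul]; congr 1; push_cast; ring

theorem qNu_three : P.q ^ (3 / 2 * (P.nu + P.nuP)) = P.qNu ^ 3 := by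
  unfold Params.qNu
  rw [← Complex.cpow_nat_mul]; congr 1; push_cast; ring

theorem phi_eq (t : RatFunc ℂ) : phi P t = phiK (RatFunc.C P.qNu) (RatFunc.C P.q)
    (RatFunc.C (Complex.exp P.muP)) (RatFunc.C (Complex.exp P.mu)) (RatFunc.C (P.q ^ P.twoS))
    (RatFunc.C P.v) t := by
  unfold phi phiK
  simp only [Complex.exp_add, Complex.exp_neg, map_mul, map_inv₀, map_pow, map_div₀, map_one,
    map_ofNat]
  ring

theorem multA_eq : multA P = cK (RatFunc.C P.qNu) (RatFunc.C P.q)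
    (RatFunc.C (Complex.exp P.muP)) (RatFunc.C (Complex.exp P.mu)) (RatFunc.C (P.q ^ P.twoS))
    (RatFunc.C P.v) RatFunc.X := by
  unfold multA cK Complex.cosh
  simp only [Complex.exp_neg, map_mul, map_inv₀, map_pow, map_div₀, map_one,
    map_ofNat, map_sub, map_add, pow_succ _ P.twoS, mul_inv]
  ring

theorem scal_eq : RatFunc.C (1 / 2 * P.qNu * (Complex.exp P.muP * (P.q ^ P.twoS)⁻¹
        + Complex.exp (-P.muP) * P.q ^ P.twoS)) = kK (RatFunc.C P.qNu)
    (RatFunc.C (Complex.exp P.muP)) (RatFunc.C (P.q ^ P.twoS)) := by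
  unfold kK
  simp only [Complex.exp_neg, map_mul, map_inv₀, map_pow, map_div₀, map_one,
    map_ofNat, map_add]
  ring

theorem rho_eq : RatFunc.C P.rho = rhoK (RatFunc.C P.qNu) (RatFunc.C P.q) := by
  unfold rhoK Params.rho
  rw [qNu_ne]
  simp only [map_mul, map_inv₀, map_pow, map_div₀, map_one, map_ofNat, map_sub, map_neg]

theorem omega_eq : RatFunc.C P.omega = omK (RatFunc.C P.qNu) (RatFunc.C P.q)
    (RatFunc.C (Complex.exp P.muP)) (RatFunc.C (Complex.exp P.mu)) (RatFunc.C (P.q ^ P.twoS))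
    (RatFunc.C P.v) := by
  unfold omK Params.omega Complex.cosh
  rw [qNu_ne]
  simp only [Complex.exp_neg, map_mul, map_inv₀, map_pow, map_div₀, map_one, map_ofNat, map_add,
    map_sub, pow_succ _ P.twoS, mul_inv]
  ring

theorem eta_eq : RatFunc.C P.eta = etaK (RatFunc.C P.qNu) (RatFunc.C P.q)
    (RatFunc.C (Complex.exp P.muP)) (RatFunc.C (Complex.exp P.mu)) (RatFunc.C (P.q ^ P.twoS))
    (RatFunc.C P.v) := by
  unfold etaK Params.eta Complex.cosh
  rw [qNu_three]
  simp only [Complex.exp_neg, map_mul, map_inv₀, map_pow, map_div₀, map_one, map_ofNat, map_add,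
    map_sub, map_neg, pow_succ _ P.twoS, mul_inv]

theorem etaStar_eq : RatFunc.C P.etaStar = etaK (RatFunc.C P.qNu) (RatFunc.C P.q)
    (RatFunc.C (Complex.exp P.mu)) (RatFunc.C (Complex.exp P.muP)) (RatFunc.C (P.q ^ P.twoS))
    (RatFunc.C P.v) := by
  unfold etaK Params.etaStar Complex.cosh
  rw [qNu_three]
  simp only [Complex.exp_neg, map_mul, map_inv₀, map_pow, map_div₀, map_one, map_ofNat, map_add,
    map_sub, map_neg, pow_succ _ P.twoS, mul_inv]

theorem opA_apply (f : RatFunc ℂ) : opA P f =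
    (RatFunc.C P.q)⁻¹ * RatFunc.X⁻¹ * phi P RatFunc.X * (Tplus P f - f)
    + (RatFunc.C P.q)⁻¹ * RatFunc.X * phi P RatFunc.X⁻¹ * (Tminus P f - f) + multA P * f := by
  simp [opA, map_inv₀, mul_assoc]

theorem opAStar_apply (f : RatFunc ℂ) : opAStar P f =
    phi P RatFunc.X * (Tplus P f - f) + phi P RatFunc.X⁻¹ * (Tminus P f - f)
    + kK (RatFunc.C P.qNu) (RatFunc.C (Complex.exp P.muP)) (RatFunc.C (P.q ^ P.twoS)) * f := by
  rw [← scal_eq]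
  simp only [opAStar, LinearMap.add_apply, Module.End.mul_apply, LinearMap.sub_apply,
    Module.End.one_apply, LinearMap.mulLeft_apply, LinearMap.smul_apply, AlgHom.toLinearMap_apply]
  rw [Algebra.smul_def, RatFunc.algebraMap_eq_C]

theorem den_ne :
    RatFunc.C P.q ≠ 0 ∧ (RatFunc.X : RatFunc ℂ) ≠ 0 ∧ 1 - (RatFunc.X : RatFunc ℂ) ^ 2 ≠ 0 ∧
    1 - RatFunc.C P.q ^ 2 * RatFunc.X ^ 2 ≠ 0 ∧ 1 - RatFunc.C P.q ^ 4 * RatFunc.X ^ 2 ≠ 0 ∧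
    RatFunc.X ^ 2 - RatFunc.C P.q ^ 2 ≠ 0 ∧ RatFunc.X ^ 2 - RatFunc.C P.q ^ 4 ≠ 0 ∧
    RatFunc.C P.q ^ 2 + 1 ≠ 0 := by
  have hq := P.q_ne_zero
  refine ⟨by simpa using hq, RatFunc.X_ne_zero, ?_, ?_, ?_, ?_, ?_, ?_⟩
  · have h := quad_ne_zero 1 (-1) one_ne_zero
    intro h0; apply h; rw [← h0]; simp; ring
  · have h := quad_ne_zero 1 (-P.q ^ 2) one_ne_zero
    intro h0; apply h; rw [← h0]; simp; ring
  · have h := quad_ne_zero 1 (-P.q ^ 4) one_ne_zero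
    intro h0; apply h; rw [← h0]; simp; ring
  · have h := quad_ne_zero (-P.q ^ 2) 1 (by simpa using hq)
    intro h0; apply h; rw [← h0]; simp; ring
  · have h := quad_ne_zero (-P.q ^ 4) 1 (by simpa using hq)
    intro h0; apply h; rw [← h0]; simp; ring
  · intro h
    have h1 : RatFunc.C (P.q ^ 2 + 1) = 0 := by simpa using h
    have h2 : P.q ^ 2 + 1 = 0 := (map_eq_zero _).1 h1
    refine P.q_pow_ne_one 4 (by norm_num) ?_
    linear_combination (P.q ^ 2 - 1) * h2

theorem par_ne :
    RatFunc.C (Complex.exp P.muP) ≠ 0 ∧ RatFunc.C (Complex.exp P.mu) ≠ 0 ∧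
    RatFunc.C (P.q ^ P.twoS) ≠ 0 ∧ RatFunc.C P.v ≠ 0 := by
  have hq := P.q_ne_zero
  have hv := P.v_ne_zero
  refine ⟨?_, ?_, ?_, ?_⟩ <;> simp [Complex.exp_ne_zero, hq, hv]

theorem Tplus_X : Tplus P RatFunc.X = RatFunc.C P.q ^ 2 * RatFunc.X := by
  rw [Tplus, scale_X, map_pow]

theorem Tminus_X : Tminus P RatFunc.X = (RatFunc.C P.q ^ 2)⁻¹ * RatFunc.X := by
  rw [Tminus, scale_X, map_inv₀, map_pow]

theorem Tplus_C (a : ℂ) : Tplus P (RatFunc.C a) = RatFunc.C a := scale_C _ _ _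

theorem Tminus_C (a : ℂ) : Tminus P (RatFunc.C a) = RatFunc.C a := scale_C _ _ _

/-- The image of `[A*, A]_q` is a multiplication operator. -/
theorem qComm_op (f : RatFunc ℂ) :
    RatFunc.C P.q * opAStar P (opA P f) - (RatFunc.C P.q)⁻¹ * opA P (opAStar P f) =
    xK (RatFunc.C P.qNu) (RatFunc.C P.q)
      (RatFunc.C (Complex.exp P.muP)) (RatFunc.C (Complex.exp P.mu)) (RatFunc.C (P.q ^ P.twoS))
      (RatFunc.C P.v) RatFunc.X * f := by
  obtain ⟨hq, hz, h1, h2, h3, h4, h5, -⟩ := den_ne P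
  obtain ⟨hE, hm, hy, hv⟩ := par_ne P
  have hp := Tplus_C P
  have hn := Tminus_C P
  refine qcomm_mult (Tplus P : RatFunc ℂ →+* RatFunc ℂ) (Tminus P : RatFunc ℂ →+* RatFunc ℂ)
    (Tplus_Tminus P) (Tminus_Tplus P)
    (RatFunc.C P.q) RatFunc.X (kK (RatFunc.C P.qNu) (RatFunc.C (Complex.exp P.muP))
      (RatFunc.C (P.q ^ P.twoS))) (multA P) (phi P RatFunc.X) (phi P RatFunc.X⁻¹) _ hq hz
    (hp _) (hn _) (Tplus_X P) (Tminus_X P) ?_ ?_ ?_ ?_ ?_ (opA P) (opAStar P) (opA_apply P)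
    (opAStar_apply P) f
  · simp only [kK, AlgHom.coe_toRingHom, map_mul, map_add, map_inv₀, map_div₀, map_ofNat, hp]
  · simp only [kK, AlgHom.coe_toRingHom, map_mul, map_add, map_inv₀, map_div₀, map_ofNat, hn]
  · have h := id1 (RatFunc.C P.qNu) (RatFunc.C P.q) (RatFunc.C (Complex.exp P.muP))
      (RatFunc.C (Complex.exp P.mu)) (RatFunc.C (P.q ^ P.twoS)) (RatFunc.C P.v) RatFunc.X
      hq hE hm hy hv hz h1 h2 h3 h4
    rw [phi_eq, phi_eq, multA_eq]
    convert h using 2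
    · simp only [phiK, AlgHom.coe_toRingHom, map_mul, map_add, map_sub, map_inv₀, map_div₀,
        map_ofNat, map_pow, map_one, hp, Tplus_X]
    · congr 4
      simp only [cK, AlgHom.coe_toRingHom, map_mul, map_add, map_sub, map_inv₀, map_div₀,
        map_ofNat, map_pow, hp, Tplus_X]
  · have h1' : 1 - (RatFunc.X⁻¹ : RatFunc ℂ) ^ 2 ≠ 0 := by
      intro h; apply h1; field_simp at h; linear_combination -h
    have h2' : 1 - RatFunc.C P.q ^ 2 * RatFunc.X⁻¹ ^ 2 ≠ 0 := by
      intro h; apply h4; field_simp at h; linear_combination h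
    have h3' : 1 - RatFunc.C P.q ^ 4 * RatFunc.X⁻¹ ^ 2 ≠ 0 := by
      intro h; apply h5; field_simp at h; linear_combination h
    have h4' : RatFunc.X⁻¹ ^ 2 - RatFunc.C P.q ^ 2 ≠ 0 := by
      intro h; apply h2; field_simp at h; linear_combination h
    have h := id1 (RatFunc.C P.qNu) (RatFunc.C P.q) (RatFunc.C (Complex.exp P.muP))
      (RatFunc.C (Complex.exp P.mu)) (RatFunc.C (P.q ^ P.twoS)) (RatFunc.C P.v) RatFunc.X⁻¹
      hq hE hm hy hv (inv_ne_zero hz) h1' h2' h3' h4'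
    rw [phi_eq, phi_eq, multA_eq]
    rw [inv_inv, cK_inv] at h
    have e : (RatFunc.C P.q ^ 2 * (RatFunc.X : RatFunc ℂ)⁻¹)⁻¹ =
      (RatFunc.C P.q ^ 2)⁻¹ * RatFunc.X := by rw [mul_inv, inv_inv]
    rw [← cK_inv _ _ _ _ _ _ (RatFunc.C P.q ^ 2 * RatFunc.X⁻¹), e] at h
    rw [e]
    convert h using 2
    · simp only [phiK, AlgHom.coe_toRingHom, map_mul, map_add, map_sub, map_inv₀, map_div₀,
        map_ofNat, map_pow, map_one, hn, Tminus_X]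
    · congr 4
      simp only [cK, AlgHom.coe_toRingHom, map_mul, map_add, map_sub, map_inv₀, map_div₀,
        map_ofNat, map_pow, hn, Tminus_X]
  · have h := id2 (RatFunc.C P.qNu) (RatFunc.C P.q) (RatFunc.C (Complex.exp P.muP))
      (RatFunc.C (Complex.exp P.mu)) (RatFunc.C (P.q ^ P.twoS)) (RatFunc.C P.v) RatFunc.X
      hq hE hm hy hv hz h1 h2 h4
    rw [phi_eq, phi_eq, multA_eq]
    unfold xK
    rw [← h]
    simp only [cK, AlgHom.coe_toRingHom, map_mul, map_add, map_sub, map_inv₀, map_div₀,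
        map_ofNat, map_pow, hp, hn, Tplus_X, Tminus_X]

/-- The rational function of the multiplication operator `[A*, A]_q`, at the point `t`. -/
def xRat (t : RatFunc ℂ) : RatFunc ℂ :=
  xK (RatFunc.C P.qNu) (RatFunc.C P.q)
      (RatFunc.C (Complex.exp P.muP)) (RatFunc.C (Complex.exp P.mu)) (RatFunc.C (P.q ^ P.twoS))
      (RatFunc.C P.v) t

theorem xRat_def (t : RatFunc ℂ) : xRat P t = xK (RatFunc.C P.qNu) (RatFunc.C P.q)
      (RatFunc.C (Complex.exp P.muP)) (RatFunc.C (Complex.exp P.mu)) (RatFunc.C (P.q ^ P.twoS))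
      (RatFunc.C P.v) t := rfl

theorem qComm_apply (f : RatFunc ℂ) :
    qComm P.q (opAStar P) (opA P) f = xRat P RatFunc.X * f := by
  rw [xRat, ← qComm_op]
  simp [qComm, Algebra.smul_def, RatFunc.algebraMap_eq_C]

theorem Tplus_xRat : Tplus P (xRat P RatFunc.X) = xRat P (RatFunc.C P.q ^ 2 * RatFunc.X) := by
  simp only [xRat, xK, map_mul, map_add, map_sub, map_inv₀, map_div₀,
        map_ofNat, map_pow, Tplus_C, Tplus_X]

theorem Tminus_xRat :
    Tminus P (xRat P RatFunc.X) = xRat P ((RatFunc.C P.q ^ 2)⁻¹ * RatFunc.X) := by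
  simp only [xRat, xK, map_mul, map_add, map_sub, map_inv₀, map_div₀,
        map_ofNat, map_pow, Tminus_C, Tminus_X]

theorem xRat_shift_inv :
    (RatFunc.C P.q)⁻¹ * xRat P ((RatFunc.C P.q ^ 2)⁻¹ * RatFunc.X)
      - RatFunc.C P.q * xRat P RatFunc.X =
      RatFunc.C P.rho * ((RatFunc.C P.q)⁻¹ * RatFunc.X) + RatFunc.C P.omega ∧
    (RatFunc.C P.q)⁻¹ * xRat P RatFunc.X
      - RatFunc.C P.q * xRat P ((RatFunc.C P.q ^ 2)⁻¹ * RatFunc.X) =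
      RatFunc.C P.rho * (RatFunc.C P.q * RatFunc.X⁻¹) + RatFunc.C P.omega := by
  obtain ⟨hq, hz, -⟩ := den_ne P
  have h := xK_shift (RatFunc.C P.qNu) (RatFunc.C P.q)
      (RatFunc.C (Complex.exp P.muP)) (RatFunc.C (Complex.exp P.mu)) (RatFunc.C (P.q ^ P.twoS))
      (RatFunc.C P.v) RatFunc.X⁻¹ hq (inv_ne_zero hz)
  rw [← xK_inv _ _ _ _ _ _ (RatFunc.C P.q ^ 2 * RatFunc.X⁻¹), mul_inv, inv_inv, xK_inv,
    ← rho_eq, ← omega_eq] at h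
  exact h

theorem awRel₂ :
    qComm P.q⁻¹ (opAStar P) (qComm P.q (opAStar P) (opA P)) =
      P.rho • opA P + P.omega • opAStar P + P.etaStar • 1 := by
  obtain ⟨hq, hz, h1, h2, h3, h4, h5, h6⟩ := den_ne P
  obtain ⟨hE, hm, hy, hv⟩ := par_ne P
  refine LinearMap.ext fun f => ?_
  have key : (RatFunc.C P.q)⁻¹ * opAStar P (xRat P RatFunc.X * f)
      - RatFunc.C P.q * (xRat P RatFunc.X * opAStar P f) =
      RatFunc.C P.rho * opA P f + RatFunc.C P.omega * opAStar P f + RatFunc.C P.etaStar * f := by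
    have s1 := (xK_shift (RatFunc.C P.qNu) (RatFunc.C P.q)
      (RatFunc.C (Complex.exp P.muP)) (RatFunc.C (Complex.exp P.mu)) (RatFunc.C (P.q ^ P.twoS))
      (RatFunc.C P.v) RatFunc.X hq hz).1
    have s2 := (xRat_shift_inv P).1
    have s3 := id4 (RatFunc.C P.qNu) (RatFunc.C P.q)
      (RatFunc.C (Complex.exp P.muP)) (RatFunc.C (Complex.exp P.mu)) (RatFunc.C (P.q ^ P.twoS))
      (RatFunc.C P.v) RatFunc.X hq hE hm hy hv hz h1 h2 h4 h6
    rw [← rho_eq, ← omega_eq] at s1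
    rw [← rho_eq, ← omega_eq, ← etaStar_eq, ← phi_eq, ← phi_eq, ← multA_eq] at s3
    simp only [← xRat_def] at s1 s2 s3
    simp only [opAStar_apply, opA_apply, map_mul, Tplus_xRat, Tminus_xRat]
    linear_combination phi P RatFunc.X * (Tplus P f - f) * s1
      + phi P RatFunc.X⁻¹ * (Tminus P f - f) * s2 + f * s3
  have e : qComm P.q⁻¹ (opAStar P) (qComm P.q (opAStar P) (opA P)) f =
      P.q⁻¹ • opAStar P (qComm P.q (opAStar P) (opA P) f)
        - P.q • qComm P.q (opAStar P) (opA P) (opAStar P f) := by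
    rw [qComm]; simp
  rw [e, qComm_apply, qComm_apply]
  simp only [LinearMap.add_apply, LinearMap.smul_apply, Module.End.one_apply]
  simp only [Algebra.smul_def, RatFunc.algebraMap_eq_C, map_inv₀]
  exact key

theorem qComm_qComm {R : Type*} [Ring R] [Algebra ℂ R] (q : ℂ) (a b : R) :
    qComm q⁻¹ a (qComm q a b) = qComm q⁻¹ (qComm q b a) a := by
  simp only [qComm, mul_sub, sub_mul, mul_smul_comm, smul_mul_assoc, smul_sub, smul_smul,
    mul_assoc, inv_inv]
  module

theorem awRel₁ :
    qComm P.q⁻¹ (opA P) (qComm P.q (opA P) (opAStar P)) =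
      P.rho • opAStar P + P.omega • opA P + P.eta • 1 := by
  obtain ⟨hq, hz, h1, h2, h3, h4, h5, h6⟩ := den_ne P
  obtain ⟨hE, hm, hy, hv⟩ := par_ne P
  rw [qComm_qComm]
  refine LinearMap.ext fun f => ?_
  have key : (RatFunc.C P.q)⁻¹ * (xRat P RatFunc.X * opA P f)
      - RatFunc.C P.q * opA P (xRat P RatFunc.X * f) =
      RatFunc.C P.rho * opAStar P f + RatFunc.C P.omega * opA P f + RatFunc.C P.eta * f := by
    have s1 := (xK_shift (RatFunc.C P.qNu) (RatFunc.C P.q)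
      (RatFunc.C (Complex.exp P.muP)) (RatFunc.C (Complex.exp P.mu)) (RatFunc.C (P.q ^ P.twoS))
      (RatFunc.C P.v) RatFunc.X hq hz).2
    have s2 := (xRat_shift_inv P).2
    have s3 := id3 (RatFunc.C P.qNu) (RatFunc.C P.q)
      (RatFunc.C (Complex.exp P.muP)) (RatFunc.C (Complex.exp P.mu)) (RatFunc.C (P.q ^ P.twoS))
      (RatFunc.C P.v) RatFunc.X hq hE hm hy hv hz h1 h2 h4 h6
    rw [← rho_eq, ← omega_eq] at s1
    rw [← rho_eq, ← omega_eq, ← eta_eq, ← phi_eq, ← phi_eq, ← multA_eq] at s3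
    simp only [← xRat_def] at s1 s2 s3
    simp only [opAStar_apply, opA_apply, map_mul, Tplus_xRat, Tminus_xRat]
    have c1 : (RatFunc.C P.q)⁻¹ * RatFunc.C P.q = 1 := inv_mul_cancel₀ hq
    have c2 : (RatFunc.X : RatFunc ℂ)⁻¹ * RatFunc.X = 1 := inv_mul_cancel₀ hz
    have t1 := congrArg (fun t => (RatFunc.C P.q)⁻¹ * RatFunc.X⁻¹ * t) s1
    have t2 := congrArg (fun t => (RatFunc.C P.q)⁻¹ * RatFunc.X * t) s2
    have e1 : (RatFunc.C P.q)⁻¹ * RatFunc.X⁻¹ * (RatFunc.C P.rho * (RatFunc.C P.q * RatFunc.X)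
        + RatFunc.C P.omega) =
        RatFunc.C P.rho + (RatFunc.C P.q)⁻¹ * RatFunc.X⁻¹ * RatFunc.C P.omega := by
      field_simp
    have e2 : (RatFunc.C P.q)⁻¹ * RatFunc.X * (RatFunc.C P.rho * (RatFunc.C P.q * RatFunc.X⁻¹)
        + RatFunc.C P.omega) =
        RatFunc.C P.rho + (RatFunc.C P.q)⁻¹ * RatFunc.X * RatFunc.C P.omega := by
      field_simp
    have e3 : (RatFunc.C P.q)⁻¹ * RatFunc.X⁻¹ * RatFunc.C P.q = RatFunc.X⁻¹ := by field_simp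
    have e4 : (RatFunc.C P.q)⁻¹ * RatFunc.X * RatFunc.C P.q = RatFunc.X := by field_simp
    simp only [e1, e2] at t1 t2
    linear_combination phi P RatFunc.X * (Tplus P f - f) * t1
      + phi P RatFunc.X⁻¹ * (Tminus P f - f) * t2 + f * s3
      + phi P RatFunc.X * f *
        (xRat P RatFunc.X - xRat P (RatFunc.C P.q ^ 2 * RatFunc.X)) * e3
      + phi P RatFunc.X⁻¹ * f *
        (xRat P RatFunc.X - xRat P ((RatFunc.C P.q ^ 2)⁻¹ * RatFunc.X)) * e4
  have e : qComm P.q⁻¹ (qComm P.q (opAStar P) (opA P)) (opA P) f =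
      P.q⁻¹ • qComm P.q (opAStar P) (opA P) (opA P f)
        - P.q • opA P (qComm P.q (opAStar P) (opA P) f) := by
    rw [qComm]; simp
  rw [e, qComm_apply, qComm_apply]
  simp only [LinearMap.add_apply, LinearMap.smul_apply, Module.End.one_apply]
  simp only [Algebra.smul_def, RatFunc.algebraMap_eq_C, map_inv₀]
  exact key

end Bridge

/-- The representation `π` of the Askey-Wilson algebra on `ℂ(z)` by `q`-difference operators,
sending `A` to `opA` and `A*` to `opAStar`. -/
def piRep (P : Params) : AWAlgebra P →ₐ[ℂ] Module.End ℂ (RatFunc ℂ) :=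
  RingQuot.liftAlgHom ℂ ⟨FreeAlgebra.lift ℂ ![opA P, opAStar P], by
    intro x y h
    cases h with
    | rel₁ => simpa [qComm] using awRel₁ P
    | rel₂ => simpa [qComm] using awRel₂ P⟩

theorem piRep_genA (P : Params) : piRep P (genA P) = opA P := by
  simp [piRep, genA]

theorem piRep_genAStar (P : Params) : piRep P (genAStar P) = opAStar P := by
  simp [piRep, genAStar]

/-! ### Symmetrized variables, Bethe equations and `Q`-polynomials -/

/-- `b(x) = x - x⁻¹`. -/
def bFun (x : ℂ) : ℂ := x - x⁻¹

/-- The symmetrized variable `U = (q u² + q⁻¹ u⁻²) / (q + q⁻¹)`. -/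
def symVar (P : Params) (u : ℂ) : ℂ :=
  (P.q * u ^ 2 + P.q⁻¹ * (u ^ 2)⁻¹) / (P.q + P.q⁻¹)

/-- The element `Z = (z + z⁻¹) / (q + q⁻¹)` of `ℂ(z)`. -/
def bigZ (P : Params) : RatFunc ℂ :=
  (RatFunc.X + RatFunc.X⁻¹) / RatFunc.C (P.q + P.q⁻¹)

/-- `X_k = (q^{2k-2s} v² + q^{-2k+2s} v⁻²) / (q + q⁻¹)`. -/
def Xk (P : Params) (k : ℕ) : ℂ :=
  (P.q ^ (2 * (k : ℤ) - (P.twoS : ℤ)) * P.v ^ 2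
    + P.q ^ ((P.twoS : ℤ) - 2 * (k : ℤ)) * (P.v ^ 2)⁻¹) / (P.q + P.q⁻¹)

/-- The polynomial `H` of degree `2s + 1`,
`H(U) = (q + q⁻¹)^{2s+1} ∑_k (-1)^k e_k(X_0, …, X_{2s}) U^{2s+1-k}`. -/
def hPoly (P : Params) : Polynomial ℂ :=
  Polynomial.C ((P.q + P.q⁻¹) ^ (P.twoS + 1)) *
    ∑ k ∈ Finset.range (P.twoS + 2),
      Polynomial.C ((-1) ^ k * ((Multiset.range (P.twoS + 1)).map (Xk P)).esymm k)
        * Polynomial.X ^ (P.twoS + 1 - k)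

/-- The scalar `δ_d` (for the reference state with sign `+`). -/
def deltaD (P : Params) : ℂ :=
  -((-1) ^ (P.twoS + 1) / 2) * Complex.exp (-P.muP) * (P.qNu * (P.q ^ (P.twoS + 2))⁻¹)

/-- The function `F₊(u)`. -/
def fPlus (P : Params) (u : ℂ) : ℂ :=
  Complex.exp (-P.muP) * (P.q ^ (P.twoS + 1))⁻¹
    * (P.q ^ (P.twoS + 1) * u * P.v⁻¹ - u⁻¹ * P.v)
    * (P.q ^ (P.twoS + 1) * u * P.v - u⁻¹ * P.v⁻¹)
    * (u + Complex.exp (P.mu + P.muP) * u⁻¹)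
    * (u + Complex.exp (P.muP - P.mu) * u⁻¹)

/-- `Δ_sp(u) = 1`. -/
def deltaSp (_u : ℂ) : ℂ := 1

/-- `Δ_d(u) = u (κ u + κ* u⁻¹)`. -/
def deltaDiag (κ κs u : ℂ) : ℂ := u * (κ * u + κs * u⁻¹)

/-- The coefficient of `z ^ j` in `F₊(u)`, as a Laurent polynomial in `z = q u²`. -/
def fCoeff (P : Params) : ℤ → ℂ
  | 2 => Complex.exp (-P.muP) * P.q ^ P.twoS * P.q⁻¹
  | 1 => 2 * Complex.cosh P.mu * P.q ^ P.twoS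
      - (P.v ^ 2 + (P.v ^ 2)⁻¹) * Complex.exp (-P.muP) * P.q⁻¹
  | 0 => Complex.exp P.muP * P.q ^ (P.twoS + 1) + Complex.exp (-P.muP) * (P.q ^ (P.twoS + 1))⁻¹
      - 2 * (P.v ^ 2 + (P.v ^ 2)⁻¹) * Complex.cosh P.mu
  | -1 => 2 * Complex.cosh P.mu * (P.q ^ P.twoS)⁻¹
      - (P.v ^ 2 + (P.v ^ 2)⁻¹) * Complex.exp P.muP * P.q
  | -2 => Complex.exp P.muP * P.q * (P.q ^ P.twoS)⁻¹
  | _ => 0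

/-- The coefficient of `z ^ j` in `Δ(u) F₊(u)` when `Δ(u) = d₀ + d₁ z`, `z = q u²`. -/
def gCoeff (P : Params) (d₀ d₁ : ℂ) (j : ℤ) : ℂ := d₀ * fCoeff P j + d₁ * fCoeff P (j - 1)

/-- The polynomial `g^{(odd)}(U)` attached to `Δ(u) = d₀ + d₁ q u²`; see `gOdd_symVar`. -/
def gOdd (P : Params) (d₀ d₁ U : ℂ) : ℂ :=
  2 * gCoeff P d₀ d₁ 0 + (gCoeff P d₀ d₁ 1 + gCoeff P d₀ d₁ (-1)) * ((P.q + P.q⁻¹) * U)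
    + (gCoeff P d₀ d₁ 2 + gCoeff P d₀ d₁ (-2)) * (((P.q + P.q⁻¹) * U) ^ 2 - 2)
    + gCoeff P d₀ d₁ 3 * (((P.q + P.q⁻¹) * U) ^ 3 - 3 * ((P.q + P.q⁻¹) * U))

/-- The polynomial `g^{(even)}(U)` attached to `Δ(u) = d₀ + d₁ q u²`; see `gEven_symVar`. -/
def gEven (P : Params) (d₀ d₁ U : ℂ) : ℂ :=
  -((gCoeff P d₀ d₁ 1 - gCoeff P d₀ d₁ (-1))
    + (gCoeff P d₀ d₁ 2 - gCoeff P d₀ d₁ (-2)) * ((P.q + P.q⁻¹) * U)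
    + gCoeff P d₀ d₁ 3 * (((P.q + P.q⁻¹) * U) ^ 2 - 1))

/-- The polynomial `g₀^{(N)}(U)`, `N` even, with `g₀^{(N)}(U) = b(q u²)^N`; see `g0_symVar`. -/
def g0 (P : Params) (N : ℕ) (U : ℂ) : ℂ := (((P.q + P.q⁻¹) * U) ^ 2 - 4) ^ (N / 2)

theorem q_add_inv_ne (P : Params) : P.q + P.q⁻¹ ≠ 0 := by
  intro h
  have hq := P.q_ne_zero
  refine P.q_pow_ne_one 4 (by norm_num) ?_
  field_simp at h
  linear_combination (P.q ^ 2 - 1) * h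

theorem mul_symVar (P : Params) (u : ℂ) :
    (P.q + P.q⁻¹) * symVar P u = P.q * u ^ 2 + P.q⁻¹ * (u ^ 2)⁻¹ := by
  rw [symVar, mul_div_cancel₀ _ (q_add_inv_ne P)]

theorem g0_symVar (P : Params) (u : ℂ) (hu : u ≠ 0) (N : ℕ) (hN : Even N) :
    g0 P N (symVar P u) = bFun (P.q * u ^ 2) ^ N := by
  have hq := P.q_ne_zero
  obtain ⟨k, rfl⟩ := hN
  have e : (P.q * u ^ 2 + P.q⁻¹ * (u ^ 2)⁻¹) ^ 2 - 4 = bFun (P.q * u ^ 2) ^ 2 := by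
    unfold bFun; field_simp; ring
  rw [g0, mul_symVar, e, ← pow_mul]
  congr 1; omega

theorem fPlus_eq (P : Params) (u : ℂ) (hu : u ≠ 0) :
    fPlus P u = fCoeff P 2 * (P.q * u ^ 2) ^ 2 + fCoeff P 1 * (P.q * u ^ 2) + fCoeff P 0
      + fCoeff P (-1) * (P.q * u ^ 2)⁻¹ + fCoeff P (-2) * (P.q * u ^ 2)⁻¹ ^ 2 := by
  have hq := P.q_ne_zero
  have hv := P.v_ne_zero
  have hE := Complex.exp_ne_zero P.muP
  have hm := Complex.exp_ne_zero P.mu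
  have hy : P.q ^ P.twoS ≠ 0 := pow_ne_zero _ hq
  simp only [fPlus, fCoeff, Complex.cosh, Complex.exp_neg, Complex.exp_add, Complex.exp_sub,
    pow_succ _ P.twoS]
  generalize P.q ^ P.twoS = y at *
  generalize Complex.exp P.muP = E at *
  generalize Complex.exp P.mu = m at *
  field_simp
  ring

theorem deltaSp_eq (P : Params) (u : ℂ) : deltaSp u = 1 + 0 * (P.q * u ^ 2) := by
  simp [deltaSp]

theorem deltaDiag_eq (P : Params) (κ κs u : ℂ) (hu : u ≠ 0) :
    deltaDiag κ κs u = κs + κ * P.q⁻¹ * (P.q * u ^ 2) := by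
  have hq := P.q_ne_zero
  unfold deltaDiag; field_simp; ring

theorem gOdd_symVar (P : Params) (d₀ d₁ : ℂ) (Δ : ℂ → ℂ)
    (hΔ : ∀ u, u ≠ 0 → Δ u = d₀ + d₁ * (P.q * u ^ 2)) (u : ℂ) (hu : u ≠ 0) :
    Δ u * fPlus P u + Δ (P.q⁻¹ * u⁻¹) * fPlus P (P.q⁻¹ * u⁻¹) = gOdd P d₀ d₁ (symVar P u) := by
  have hq := P.q_ne_zero
  have hw : P.q⁻¹ * u⁻¹ ≠ 0 := mul_ne_zero (inv_ne_zero hq) (inv_ne_zero hu)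
  have e : P.q * (P.q⁻¹ * u⁻¹) ^ 2 = (P.q * u ^ 2)⁻¹ := by field_simp
  have e2 : P.q⁻¹ * (u ^ 2)⁻¹ = (P.q * u ^ 2)⁻¹ := by field_simp
  have hz : P.q * u ^ 2 ≠ 0 := mul_ne_zero hq (pow_ne_zero 2 hu)
  have f2 : fCoeff P 3 = 0 := rfl
  have f3 : fCoeff P (-3) = 0 := rfl
  rw [hΔ u hu, hΔ _ hw, fPlus_eq P u hu, fPlus_eq P _ hw, gOdd, mul_symVar, e, e2, inv_inv]
  simp only [gCoeff, Int.reduceSub, Int.reduceNeg, f2, f3]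
  generalize P.q * u ^ 2 = z at *
  field_simp
  ring

theorem gEven_symVar (P : Params) (d₀ d₁ : ℂ) (Δ : ℂ → ℂ)
    (hΔ : ∀ u, u ≠ 0 → Δ u = d₀ + d₁ * (P.q * u ^ 2)) (u : ℂ) (hu : u ≠ 0)
    (hb : bFun (P.q * u ^ 2) ≠ 0) :
    -(Δ u / bFun (P.q * u ^ 2)) * fPlus P u
      + Δ (P.q⁻¹ * u⁻¹) / bFun (P.q * u ^ 2) * fPlus P (P.q⁻¹ * u⁻¹)
      = gEven P d₀ d₁ (symVar P u) := by
  have hq := P.q_ne_zero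
  have hw : P.q⁻¹ * u⁻¹ ≠ 0 := mul_ne_zero (inv_ne_zero hq) (inv_ne_zero hu)
  have e : P.q * (P.q⁻¹ * u⁻¹) ^ 2 = (P.q * u ^ 2)⁻¹ := by field_simp
  have e2 : P.q⁻¹ * (u ^ 2)⁻¹ = (P.q * u ^ 2)⁻¹ := by field_simp
  have hz : P.q * u ^ 2 ≠ 0 := mul_ne_zero hq (pow_ne_zero 2 hu)
  have f2 : fCoeff P 3 = 0 := rfl
  have f3 : fCoeff P (-3) = 0 := rfl
  rw [hΔ u hu, hΔ _ hw, fPlus_eq P u hu, fPlus_eq P _ hw, gEven, mul_symVar, e, e2, inv_inv]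
  have key : ∀ a c d b g : ℂ, b ≠ 0 → -(a * c) + d = g * b →
      -(a / b) * c + d / b = g := by
    intro a c d b g hb h
    field_simp
    linear_combination h
  rw [div_mul_eq_mul_div]
  refine key _ _ _ _ _ hb ?_
  simp only [gCoeff, Int.reduceSub, Int.reduceNeg, f2, f3, bFun]
  generalize P.q * u ^ 2 = z at *
  field_simp
  ring

/-- The polynomial `P_a^M(U_i, Ū_i)`, where `Ū_i` is the family `U` without `U_i`, for
`Δ_a(u) = d₀ + d₁ q u²` and inhomogeneity coefficient `dbar`. -/
def bethePoly (P : Params) (d₀ d₁ dbar : ℂ) {M : ℕ} (U : Fin M → ℂ) (i : Fin M) : ℂ :=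
  ∑ k ∈ Finset.range M,
    ((-1) ^ k * (P.q + P.q⁻¹) ^ (M - 1) / 2 ^ (M - 1 - k)
      * ((Finset.univ.erase i).val.map U).esymm k
      * ∑ l ∈ Finset.range (M - k),
          ((M - 1 - k).choose l : ℂ) * (P.q - P.q⁻¹) ^ l * U i ^ (M - 1 - k - l)
            * (P.q ^ 2 + (P.q ^ 2)⁻¹) ^ (M - 1 - k - l) * g0 P (2 * (l / 2)) (U i)
            * (if Even l then gEven P d₀ d₁ (U i) else gOdd P d₀ d₁ (U i)))
    + dbar * (hPoly P).eval (U i)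

/-- The inhomogeneity coefficient of the Bethe equations in the diagonal case. -/
def deltaBarD (P : Params) (κ : ℂ) : ℂ :=
  -2 * (-1) ^ P.twoS * (P.qNu⁻¹ * P.q / (P.q - P.q⁻¹)) * κ * deltaD P

/-- `U` is an admissible solution (pairwise distinct entries) of the homogeneous Bethe equations
of the special case, for which `Δ_sp(u) = 1`. -/
def IsBetheSp (P : Params) {M : ℕ} (U : Fin M → ℂ) : Prop :=
  Function.Injective U ∧ ∀ i, bethePoly P 1 0 0 U i = 0

/-- `U` is an admissible solution (pairwise distinct entries) of the inhomogeneous Bethe equations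
of the diagonal case with `M = 2s`, for which `Δ_d(u) = u (κ u + κ* u⁻¹) = κ* + κ q⁻¹ (q u²)`. -/
def IsBetheD (P : Params) (κ κs : ℂ) (U : Fin P.twoS → ℂ) : Prop :=
  Function.Injective U ∧ ∀ i, bethePoly P κs (κ * P.q⁻¹) (deltaBarD P κ) U i = 0

/-- The `Q`-polynomial `Q(Z) = ∏_j (Z - U_j)`, as an element of `ℂ(z)`. -/
def qFun (P : Params) {M : ℕ} (U : Fin M → ℂ) : RatFunc ℂ :=
  ∏ j, (bigZ P - RatFunc.C (U j))

/-- `H(Z)`, as an element of `ℂ(z)`. -/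
def hFun (P : Params) : RatFunc ℂ := Polynomial.aeval (bigZ P) (hPoly P)

/-- The `q`-number `[n]_q = (qⁿ - q⁻ⁿ) / (q - q⁻¹)`. -/
def qNumber (P : Params) (n : ℕ) : ℂ := (P.q ^ n - (P.q ^ n)⁻¹) / (P.q - P.q⁻¹)

/-- The eigenvalue `(κ*/2) q^{(ν+ν')/2} (e^{-μ'} q^{2s-2M} + e^{μ'} q^{-2s+2M})`. -/
def eigSp (P : Params) (κs : ℂ) (M : ℕ) : ℂ :=
  κs / 2 * P.qNu * (Complex.exp (-P.muP) * P.q ^ ((P.twoS : ℤ) - 2 * (M : ℤ))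
    + Complex.exp P.muP * P.q ^ (-(P.twoS : ℤ) + 2 * (M : ℤ)))

/-- The eigenvalue of the inhomogeneous problem for `κ A`, attached to the roots `U`:
`(κ/2) q^{(ν+ν')/2} e^{-μ'} q^{-2s} ((v² + v⁻²) [2s]_q + 2 e^{μ'} cosh μ - (1 + q²) ∑ U_i)`. -/
def eigInh (P : Params) (κ : ℂ) (U : Fin P.twoS → ℂ) : ℂ :=
  κ / 2 * P.qNu * Complex.exp (-P.muP) * (P.q ^ P.twoS)⁻¹
    * ((P.v ^ 2 + (P.v ^ 2)⁻¹) * qNumber P P.twoS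
      + 2 * Complex.exp P.muP * Complex.cosh P.mu - (1 + P.q ^ 2) * ∑ i, U i)

/-- The eigenvalue `Λ_d` of the diagonal case: the eigenvalue of `κ* A*` for `M = 2s`
plus the root-dependent part coming from `κ A`. -/
def eigD (P : Params) (κ κs : ℂ) (U : Fin P.twoS → ℂ) : ℂ :=
  eigSp P κs P.twoS + eigInh P κ U

end

end HeunAW

namespace HeunAW

noncomputable section

open Polynomial

/-! Write the operator as `d₀ π(A*) + q d₁ π(A)`, so that `Δ(u) = d₀ + d₁ z` with `z = q u²`. Let
`Z₊`, `Z₋` be the images of `Z` under `T₊`, `T₋`, and let `G(z) = Δ(u) F(u)`. The difference `Z₊ -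
Z` cancels one factor in the denominator of `φ(z)`, and `z - z⁻¹` cancels the other. Hence `φ(z) (Z₊
- Z) (z - z⁻¹)` is a constant times `F` read at `z⁻¹`; replacing `z` by `z⁻¹` gives the companion
statement for `Z₋`. Because `Z₊ⁿ - Zⁿ` is divisible by `Z₊ - Z`, the operator maps polynomials in
`Z` to polynomials in `Z`: it acts as `opConst • diffMap` plus multiplication by `multPoly`
(`op_aeval`).

The Bethe polynomial at `U_i` is, up to the factor `(q + q⁻¹)^(M-1)` and the inhomogeneous term in
`H`, the value at `U_i` of `diffMap Q` (`bethePoly_eq`). Indeed `Q` vanishes at `U_i`, which leaves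
only `shiftMap` of the product of the other factors. Expanding that product in elementary symmetric
polynomials and `L_n` by the binomial theorem gives the double sum.

Consider therefore the residual `(operator) Q - Λ Q + c H`. The Bethe equations say that it vanishes
at the `M` distinct points `U_i`, while a priori its degree is at most `M + 1`. If its coefficients
of `X^(M+1)` and `X^M` vanish too, it is zero (`op_qFun`). These two coefficients are computed in
closed form (`diffMap_prod_hasTop`, `hPoly_hasTop`). In the special case the first is zero
automatically and the second fixes the eigenvalue. In the diagonal case with `M = 2s`, the
polynomial `H` has degree exactly `M + 1`, the constant `δ_d` makes `c H` cancel the top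
coefficient, and the next coefficient fixes `Λ_d`, in which `∑ U_i` and `∑ X_k` enter by Vieta. -/

/-! ### Divided differences as linear maps on `ℂ[X]` -/

/-- `g^{(even)}` as a polynomial. -/
def gEvenPoly (P : Params) (d₀ d₁ : ℂ) : ℂ[X] :=
  -(C (gCoeff P d₀ d₁ 1 - gCoeff P d₀ d₁ (-1))
    + C (gCoeff P d₀ d₁ 2 - gCoeff P d₀ d₁ (-2)) * (C (P.q + P.q⁻¹) * X)
    + C (gCoeff P d₀ d₁ 3) * ((C (P.q + P.q⁻¹) * X) ^ 2 - 1))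

/-- `g^{(odd)}` as a polynomial. -/
def gOddPoly (P : Params) (d₀ d₁ : ℂ) : ℂ[X] :=
  2 * C (gCoeff P d₀ d₁ 0) + C (gCoeff P d₀ d₁ 1 + gCoeff P d₀ d₁ (-1)) * (C (P.q + P.q⁻¹) * X)
    + C (gCoeff P d₀ d₁ 2 + gCoeff P d₀ d₁ (-2)) * ((C (P.q + P.q⁻¹) * X) ^ 2 - 2)
    + C (gCoeff P d₀ d₁ 3) * ((C (P.q + P.q⁻¹) * X) ^ 3 - 3 * (C (P.q + P.q⁻¹) * X))

theorem eval_gEvenPoly (P : Params) (d₀ d₁ u : ℂ) :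
    (gEvenPoly P d₀ d₁).eval u = gEven P d₀ d₁ u := by
  simp [gEvenPoly, gEven]

theorem eval_gOddPoly (P : Params) (d₀ d₁ u : ℂ) :
    (gOddPoly P d₀ d₁).eval u = gOdd P d₀ d₁ u := by
  simp [gOddPoly, gOdd]

/-- The polynomial `L_n` with
`L_n(Z) = (G(z⁻¹) Z₊ⁿ - G(z) Z₋ⁿ) / (z - z⁻¹)`, where `G(z) = Δ(u) F₊(u)` and
`Z_± = Z(q^{±2} z)`. The recursion expresses that `Z₊` and `Z₋` are the roots of
`x² - (q² + q⁻²) Z x + Z² + (q - q⁻¹)²`. -/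
def shiftPoly (P : Params) (d₀ d₁ : ℂ) : ℕ → ℂ[X]
  | 0 => gEvenPoly P d₀ d₁
  | 1 => C (1 / 2) * (C (P.q ^ 2 + (P.q ^ 2)⁻¹) * X * gEvenPoly P d₀ d₁
      + C (P.q - P.q⁻¹) * gOddPoly P d₀ d₁)
  | n + 2 => C (P.q ^ 2 + (P.q ^ 2)⁻¹) * X * shiftPoly P d₀ d₁ (n + 1)
      - (X ^ 2 + C ((P.q - P.q⁻¹) ^ 2)) * shiftPoly P d₀ d₁ n

/-- The polynomial `∑_{a + b = n - 1} L_a(X) X^b`. -/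
def diffPoly (P : Params) (d₀ d₁ : ℂ) : ℕ → ℂ[X]
  | 0 => 0
  | n + 1 => X * diffPoly P d₀ d₁ n + shiftPoly P d₀ d₁ n

/-- The linear map `Xⁿ ↦ L_n`. -/
def shiftMap (P : Params) (d₀ d₁ : ℂ) : ℂ[X] →ₗ[ℂ] ℂ[X] :=
  Polynomial.lsum fun n => LinearMap.toSpanSingleton ℂ ℂ[X] (shiftPoly P d₀ d₁ n)

/-- The linear map `Xⁿ ↦ ∑_{a + b = n - 1} L_a(X) X^b`. -/
def diffMap (P : Params) (d₀ d₁ : ℂ) : ℂ[X] →ₗ[ℂ] ℂ[X] :=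
  Polynomial.lsum fun n => LinearMap.toSpanSingleton ℂ ℂ[X] (diffPoly P d₀ d₁ n)

theorem shiftMap_monomial (P : Params) (d₀ d₁ : ℂ) (n : ℕ) (a : ℂ) :
    shiftMap P d₀ d₁ (monomial n a) = a • shiftPoly P d₀ d₁ n := by
  simp [shiftMap, Polynomial.lsum_apply, Polynomial.sum_monomial_index]

theorem diffMap_monomial (P : Params) (d₀ d₁ : ℂ) (n : ℕ) (a : ℂ) :
    diffMap P d₀ d₁ (monomial n a) = a • diffPoly P d₀ d₁ n := by
  simp [diffMap, Polynomial.lsum_apply, Polynomial.sum_monomial_index]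

/-- The recursion for `diffPoly` gives `diffMap (X p) = X * diffMap p + shiftMap p`, so `diffMap ((X
- u) p) = (X - u) * diffMap p + shiftMap p`, and the first term dies at `u`. This is why the Bethe
equation at `U_i` involves the elementary symmetric polynomials of the other roots only. -/
theorem eval_diffMap_X_sub_C_mul (P : Params) (d₀ d₁ u : ℂ) (p : ℂ[X]) :
    (diffMap P d₀ d₁ ((X - C u) * p)).eval u = (shiftMap P d₀ d₁ p).eval u := by
  induction p using Polynomial.induction_on' with
  | add p r hp hr => rw [mul_add, map_add, map_add, eval_add, eval_add, hp, hr]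
  | monomial n a =>
    rw [sub_mul, X_mul_monomial, C_mul_monomial, map_sub, diffMap_monomial, diffMap_monomial,
      shiftMap_monomial, diffPoly]
    simp
    ring

/-! ### The Bethe polynomials -/

/-- Binomial transforms of a sequence with `t (l + 2) = D * t l` satisfy a linear recursion. -/
theorem sum_choose_recursion {R : Type*} [CommRing R] (p r D : R) (t : ℕ → R)
    (ht : ∀ l, t (l + 2) = D * t l) (n : ℕ) :
    (∑ l ∈ Finset.range (n + 3), ((n + 2).choose l : R) * r ^ l * p ^ (n + 2 - l) * t l) =
      2 * p * (∑ l ∈ Finset.range (n + 2), ((n + 1).choose l : R) * r ^ l * p ^ (n + 1 - l) * t l)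
      - (p ^ 2 - r ^ 2 * D) *
        ∑ l ∈ Finset.range (n + 1), (n.choose l : R) * r ^ l * p ^ (n - l) * t l := by
  have pascal : ∀ (t : ℕ → R) (n : ℕ),
      (∑ l ∈ Finset.range (n + 2), ((n + 1).choose l : R) * r ^ l * p ^ (n + 1 - l) * t l) =
      p * (∑ l ∈ Finset.range (n + 1), (n.choose l : R) * r ^ l * p ^ (n - l) * t l)
      + r * ∑ l ∈ Finset.range (n + 1), (n.choose l : R) * r ^ l * p ^ (n - l) * t (l + 1) := by
    intro t n
    have h := Finset.sum_antidiagonal_choose_succ_mul (fun i j => r ^ i * p ^ j * t i) n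
    rw [Finset.Nat.sum_antidiagonal_eq_sum_range_succ_mk,
      Finset.Nat.sum_antidiagonal_eq_sum_range_succ_mk,
      Finset.Nat.sum_antidiagonal_eq_sum_range_succ_mk] at h
    simp only [← mul_assoc] at h
    rw [h, Finset.mul_sum, Finset.mul_sum]
    congr 1
    · refine Finset.sum_congr rfl fun l _ => ?_
      rw [pow_succ]; ring
    · refine Finset.sum_congr rfl fun l hl => ?_
      rw [pow_succ, Nat.choose_symm (Nat.lt_succ_iff.1 (Finset.mem_range.1 hl))]; ring
  have h1 := pascal t (n + 1)
  -- Applying Pascal's rule to the shifted sequence produces `t (l + 2)`, which `ht` folds back to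
  -- `D * t l`. No square root of `D` is needed.
  have h2 := pascal (fun l => t (l + 1)) n
  have h3 := pascal t n
  simp only [ht] at h2
  have h4 : (∑ l ∈ Finset.range (n + 1), (n.choose l : R) * r ^ l * p ^ (n - l) * (D * t l)) =
      D * ∑ l ∈ Finset.range (n + 1), (n.choose l : R) * r ^ l * p ^ (n - l) * t l := by
    rw [Finset.mul_sum]
    exact Finset.sum_congr rfl fun l _ => by ring
  rw [h4] at h2
  rw [h1, h2]
  linear_combination -p * h3

/-- With `2 Z_± = (q² + q⁻²) Z ± (q - q⁻¹)(z - z⁻¹)`, the binomial expansion of `2ⁿ L_n` collects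
even powers of `z - z⁻¹` with `g^{(even)}` and odd powers with `g^{(odd)}`. The proof does not
mention `z`: both sides satisfy the same two-term recursion and agree for `n = 0, 1`. -/
theorem eval_shiftPoly (P : Params) (d₀ d₁ u : ℂ) (n : ℕ) :
    (∑ l ∈ Finset.range (n + 1), (n.choose l : ℂ) * (P.q - P.q⁻¹) ^ l * u ^ (n - l)
        * (P.q ^ 2 + (P.q ^ 2)⁻¹) ^ (n - l) * g0 P (2 * (l / 2)) u
        * (if Even l then gEven P d₀ d₁ u else gOdd P d₀ d₁ u)) =
      2 ^ n * (shiftPoly P d₀ d₁ n).eval u := by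
  set t : ℕ → ℂ := fun l => g0 P (2 * (l / 2)) u
    * (if Even l then gEven P d₀ d₁ u else gOdd P d₀ d₁ u) with ht
  set p : ℂ := (P.q ^ 2 + (P.q ^ 2)⁻¹) * u with hp
  have hsum : ∀ n : ℕ, (∑ l ∈ Finset.range (n + 1), (n.choose l : ℂ) * (P.q - P.q⁻¹) ^ l
        * u ^ (n - l) * (P.q ^ 2 + (P.q ^ 2)⁻¹) ^ (n - l) * g0 P (2 * (l / 2)) u
        * (if Even l then gEven P d₀ d₁ u else gOdd P d₀ d₁ u)) =
      ∑ l ∈ Finset.range (n + 1), (n.choose l : ℂ) * (P.q - P.q⁻¹) ^ l * p ^ (n - l) * t l := by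
    intro n
    refine Finset.sum_congr rfl fun l _ => ?_
    rw [hp, ht, mul_pow]; ring
  have hrec : ∀ l, t (l + 2) = (((P.q + P.q⁻¹) * u) ^ 2 - 4) * t l := by
    intro l
    have e1 : 2 * ((l + 2) / 2) / 2 = l / 2 + 1 := by omega
    have e2 : 2 * (l / 2) / 2 = l / 2 := by omega
    simp only [ht, g0, e1, e2, pow_succ, Nat.even_add, even_two, iff_true]
    ring
  rw [hsum]
  induction n using Nat.twoStepInduction with
  | zero => simp [ht, g0, shiftPoly, eval_gEvenPoly]
  | one =>
    simp [Finset.sum_range_succ, ht, hp, g0, shiftPoly, eval_gEvenPoly, eval_gOddPoly]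
  | more n ih1 ih2 =>
    have hq := P.q_ne_zero
    rw [sum_choose_recursion _ _ _ _ hrec, ih1, ih2, shiftPoly]
    -- The norm of `2 Z_±` is four times `Z₊ Z₋ = Z² + (q - q⁻¹)²`, the constant in the recursion of
    -- `shiftPoly`.
    have hD : p ^ 2 - (P.q - P.q⁻¹) ^ 2 * (((P.q + P.q⁻¹) * u) ^ 2 - 4) =
        4 * (u ^ 2 + (P.q - P.q⁻¹) ^ 2) := by
      rw [hp]; field_simp; ring
    rw [hD, hp]
    simp only [eval_sub, eval_mul, eval_add, eval_C, eval_X, eval_pow]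
    ring

/-- This identifies the explicit double sum with an intrinsic object: the difference operator
applied to the `Q`-polynomial and evaluated at one of its roots. -/
theorem bethePoly_eq (P : Params) (d₀ d₁ dbar : ℂ) {M : ℕ} (U : Fin M → ℂ) (i : Fin M) :
    bethePoly P d₀ d₁ dbar U i =
      (P.q + P.q⁻¹) ^ (M - 1) * (diffMap P d₀ d₁ (∏ j, (X - C (U j)))).eval (U i)
        + dbar * (hPoly P).eval (U i) := by
  -- The index `i` forces `M > 0`, so the truncated `M - 1` is a true predecessor.
  have hM : M - 1 + 1 = M := Nat.sub_add_cancel (Fin.pos i)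
  have hprod : ∏ j ∈ Finset.univ.erase i, (X - C (U j)) =
      ∑ k ∈ Finset.range M, monomial (M - 1 - k)
        ((-1) ^ k * ((Finset.univ.erase i).val.map U).esymm k) := by
    have h := Multiset.prod_X_sub_X_eq_sum_esymm ((Finset.univ.erase i).val.map U)
    rw [Multiset.map_map] at h
    have hc : ((Finset.univ.erase i).val.map U).card = M - 1 := by simp
    rw [hc, hM] at h
    rw [Finset.prod_eq_multiset_prod]
    refine h.trans (Finset.sum_congr rfl fun k _ => ?_)
    rw [← C_mul_X_pow_eq_monomial]
    simp [mul_assoc]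
  rw [← Finset.mul_prod_erase _ _ (Finset.mem_univ i), eval_diffMap_X_sub_C_mul, hprod, bethePoly,
    map_sum, eval_finsetSum, Finset.mul_sum]
  congr 1
  refine Finset.sum_congr rfl fun k hk => ?_
  have hk' : M - k = M - 1 - k + 1 := by have := Finset.mem_range.1 hk; omega
  rw [hk', eval_shiftPoly, shiftMap_monomial, eval_smul, smul_eq_mul]
  field_simp

/-! ### The difference operators on polynomials in `Z` -/

/-- The increment of `Z` under `t ↦ q² t` is a multiple of `(1 - q² t²) / t`, and `t - t⁻¹` is a
multiple of `(1 - t²) / t`. They clear the whole denominator of `φ`, leaving a Laurent polynomial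
whose coefficients are those of `F` in `t⁻¹`. -/
theorem phiK_mul_shift {K : Type*} [Field K] [CharZero K] (N q E m y v t : K) (hq : q ≠ 0)
    (hE : E ≠ 0) (hm : m ≠ 0) (hy : y ≠ 0) (hv : v ≠ 0) (ht : t ≠ 0) (h1 : 1 - t ^ 2 ≠ 0)
    (h2 : 1 - q ^ 2 * t ^ 2 ≠ 0) (h5 : q ^ 2 + 1 ≠ 0) :
    phiK N q E m y v t *
      ((q ^ 2 * t + (q ^ 2 * t)⁻¹) / (q + q⁻¹) - (t + t⁻¹) / (q + q⁻¹)) * (t - t⁻¹) =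
    N / 2 * (q - q⁻¹) / (q + q⁻¹) *
      (E⁻¹ * y * q⁻¹ * t⁻¹ ^ 2 + ((m + m⁻¹) * y - (v ^ 2 + (v ^ 2)⁻¹) * E⁻¹ * q⁻¹) * t⁻¹
        + (E * (y * q) + E⁻¹ * (y * q)⁻¹ - (v ^ 2 + (v ^ 2)⁻¹) * (m + m⁻¹))
        + ((m + m⁻¹) * y⁻¹ - (v ^ 2 + (v ^ 2)⁻¹) * E * q) * t + E * q * y⁻¹ * t ^ 2) := by
  have a1 : q + q⁻¹ = (q ^ 2 + 1) / q := by field_simp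
  have a2 : (q ^ 2 * t + (q ^ 2 * t)⁻¹) / (q + q⁻¹) - (t + t⁻¹) / (q + q⁻¹) =
      -((1 - q ^ 2 * t ^ 2) * (q ^ 2 - 1) / (q * t * (q ^ 2 + 1))) := by
    rw [a1]; field_simp; ring
  have a3 : t - t⁻¹ = -((1 - t ^ 2) / t) := by field_simp; ring
  rw [a2, a3, a1]
  unfold phiK
  field_simp
  ring

theorem ratFuncC_q_add_inv_ne (P : Params) : RatFunc.C P.q + (RatFunc.C P.q)⁻¹ ≠ 0 := by
  rw [← map_inv₀, ← map_add]
  exact (_root_.map_ne_zero _).2 (q_add_inv_ne P)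

/-- `Z` evaluated at `t`. -/
def zAt (P : Params) (t : RatFunc ℂ) : RatFunc ℂ :=
  (t + t⁻¹) / (RatFunc.C P.q + (RatFunc.C P.q)⁻¹)

theorem bigZ_eq_zAt (P : Params) : bigZ P = zAt P RatFunc.X := by
  rw [bigZ, zAt, map_add, map_inv₀]

theorem zAt_inv (P : Params) (t : RatFunc ℂ) : zAt P t⁻¹ = zAt P t := by
  rw [zAt, zAt, inv_inv, add_comm]

theorem Tplus_bigZ (P : Params) : Tplus P (bigZ P) = zAt P (RatFunc.C P.q ^ 2 * RatFunc.X) := by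
  simp only [bigZ, zAt, map_div₀, map_add, map_inv₀, Tplus_X, Tplus_C]

theorem Tminus_bigZ (P : Params) :
    Tminus P (bigZ P) = zAt P (RatFunc.C P.q ^ 2 * RatFunc.X⁻¹) := by
  rw [← zAt_inv, mul_inv, inv_inv]
  simp only [bigZ, zAt, map_div₀, map_add, map_inv₀, Tminus_X, Tminus_C]

/-- The constant relating the difference operators to `diffMap`. -/
def opConst (P : Params) : ℂ := P.qNu / 2 * (P.q - P.q⁻¹) / (P.q + P.q⁻¹)

theorem phi_mul_shift (P : Params) (t : RatFunc ℂ) (ht : t ≠ 0) (h1 : 1 - t ^ 2 ≠ 0)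
    (h2 : 1 - RatFunc.C P.q ^ 2 * t ^ 2 ≠ 0) :
    phi P t * (zAt P (RatFunc.C P.q ^ 2 * t) - zAt P t) * (t - t⁻¹) =
      RatFunc.C (opConst P) * (RatFunc.C (fCoeff P 2) * t⁻¹ ^ 2 + RatFunc.C (fCoeff P 1) * t⁻¹
        + RatFunc.C (fCoeff P 0) + RatFunc.C (fCoeff P (-1)) * t
        + RatFunc.C (fCoeff P (-2)) * t ^ 2) := by
  obtain ⟨hq, -, -, -, -, -, -, h6⟩ := den_ne P
  obtain ⟨hE, hm, hy, hv⟩ := par_ne P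
  have h := phiK_mul_shift (RatFunc.C P.qNu) (RatFunc.C P.q) (RatFunc.C (Complex.exp P.muP))
    (RatFunc.C (Complex.exp P.mu)) (RatFunc.C (P.q ^ P.twoS)) (RatFunc.C P.v) t hq hE hm hy hv ht
    h1 h2 h6
  rw [phi_eq, zAt, zAt, h]
  simp only [opConst, fCoeff, Complex.cosh, Complex.exp_neg, map_mul, map_inv₀, map_pow, map_div₀,
    map_ofNat, map_add, map_sub, pow_succ _ P.twoS, mul_inv]
  ring

/-- The symmetrizations of a Laurent polynomial `∑ g_j z^j`, `-2 ≤ j ≤ 3`. -/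
theorem laurent_symmetrize {K : Type*} [Field K] (z k A B g3 g2 g1 g0 g1' g2' : K)
    (hz : z ≠ 0) (hb : z - z⁻¹ ≠ 0)
    (hA : A * (z - z⁻¹) = k * (g3 * z⁻¹ ^ 3 + g2 * z⁻¹ ^ 2 + g1 * z⁻¹ + g0 + g1' * z + g2' * z ^ 2))
    (hB : B * (z⁻¹ - z) = k * (g3 * z ^ 3 + g2 * z ^ 2 + g1 * z + g0 + g1' * z⁻¹ + g2' * z⁻¹ ^ 2)) :
    A + B = k * -((g1 - g1') + (g2 - g2') * (z + z⁻¹) + g3 * ((z + z⁻¹) ^ 2 - 1)) ∧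
    A * (z - z⁻¹) + B * (z⁻¹ - z) = k * (2 * g0 + (g1 + g1') * (z + z⁻¹)
      + (g2 + g2') * ((z + z⁻¹) ^ 2 - 2) + g3 * ((z + z⁻¹) ^ 3 - 3 * (z + z⁻¹))) := by
  constructor
  · apply mul_right_cancel₀ hb
    rw [add_mul, hA, show B * (z - z⁻¹) = -(B * (z⁻¹ - z)) by ring, hB]
    field_simp
    ring
  · rw [hA, hB]
    field_simp
    ring

/-- The left side has the form `A Z₊ⁿ + B Z₋ⁿ`, so it obeys the linear recursion whose
characteristic roots are `Z₊` and `Z₋`. The initial values come from the two symmetrizations: `A +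
B` gives `g^{(even)}`, and `(A - B)(z - z⁻¹)` gives `g^{(odd)}`, which enters at `n = 1`. -/
theorem shift_identity (P : Params) (d₀ d₁ : ℂ) (n : ℕ) :
    phi P RatFunc.X * (RatFunc.C d₀ + RatFunc.C d₁ * RatFunc.X⁻¹)
        * (Tplus P (bigZ P) - bigZ P) * Tplus P (bigZ P) ^ n
      + phi P RatFunc.X⁻¹ * (RatFunc.C d₀ + RatFunc.C d₁ * RatFunc.X)
        * (Tminus P (bigZ P) - bigZ P) * Tminus P (bigZ P) ^ n =
    RatFunc.C (opConst P) * aeval (bigZ P) (shiftPoly P d₀ d₁ n) := by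
  obtain ⟨hq, hz, h1, h2, -, h4, -, -⟩ := den_ne P
  have hs := ratFuncC_q_add_inv_ne P
  have h1' : 1 - (RatFunc.X⁻¹ : RatFunc ℂ) ^ 2 ≠ 0 := by
    intro h; apply h1; field_simp at h; linear_combination -h
  have h2' : 1 - RatFunc.C P.q ^ 2 * RatFunc.X⁻¹ ^ 2 ≠ 0 := by
    intro h; apply h4; field_simp at h; linear_combination h
  have hb : (RatFunc.X : RatFunc ℂ) - RatFunc.X⁻¹ ≠ 0 := by
    intro h; apply h1; field_simp at h; linear_combination -h
  have hA := phi_mul_shift P RatFunc.X hz h1 h2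
  have hB := phi_mul_shift P RatFunc.X⁻¹ (inv_ne_zero hz) h1' h2'
  rw [zAt_inv, inv_inv, ← bigZ_eq_zAt, ← Tminus_bigZ] at hB
  rw [← bigZ_eq_zAt, ← Tplus_bigZ] at hA
  have hZ : RatFunc.X + RatFunc.X⁻¹ = (RatFunc.C P.q + (RatFunc.C P.q)⁻¹) * bigZ P := by
    rw [bigZ_eq_zAt, zAt, mul_div_cancel₀ _ hs]
  have hp : 2 * Tplus P (bigZ P) = (RatFunc.C P.q ^ 2 + (RatFunc.C P.q ^ 2)⁻¹) * bigZ P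
      + (RatFunc.C P.q - (RatFunc.C P.q)⁻¹) * (RatFunc.X - RatFunc.X⁻¹) := by
    apply mul_left_cancel₀ hs
    rw [Tplus_bigZ, mul_left_comm, zAt, mul_div_cancel₀ _ hs, mul_add _ (_ * bigZ P),
      mul_left_comm _ _ (bigZ P), ← hZ]
    field_simp
    ring
  have hm : 2 * Tminus P (bigZ P) = (RatFunc.C P.q ^ 2 + (RatFunc.C P.q ^ 2)⁻¹) * bigZ P
      + (RatFunc.C P.q - (RatFunc.C P.q)⁻¹) * (RatFunc.X⁻¹ - RatFunc.X) := by
    apply mul_left_cancel₀ hs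
    rw [Tminus_bigZ, mul_left_comm, zAt, mul_div_cancel₀ _ hs, mul_add _ (_ * bigZ P),
      mul_left_comm _ _ (bigZ P), ← hZ]
    field_simp
    ring
  have hquad : (RatFunc.X - RatFunc.X⁻¹) ^ 2 =
      ((RatFunc.C P.q + (RatFunc.C P.q)⁻¹) * bigZ P) ^ 2 - 4 := by
    rw [← hZ]; field_simp; ring
  generalize Tplus P (bigZ P) = Zp at *
  generalize Tminus P (bigZ P) = Zm at *
  set A := phi P RatFunc.X * (RatFunc.C d₀ + RatFunc.C d₁ * RatFunc.X⁻¹) * (Zp - bigZ P) with hA'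
  set B := phi P RatFunc.X⁻¹ * (RatFunc.C d₀ + RatFunc.C d₁ * RatFunc.X) * (Zm - bigZ P) with hB'
  have f3 : fCoeff P 3 = 0 := rfl
  have f3' : fCoeff P (-3) = 0 := rfl
  have hsym := laurent_symmetrize RatFunc.X (RatFunc.C (opConst P)) A B
    (RatFunc.C (gCoeff P d₀ d₁ 3)) (RatFunc.C (gCoeff P d₀ d₁ 2)) (RatFunc.C (gCoeff P d₀ d₁ 1))
    (RatFunc.C (gCoeff P d₀ d₁ 0)) (RatFunc.C (gCoeff P d₀ d₁ (-1)))
    (RatFunc.C (gCoeff P d₀ d₁ (-2))) hz hb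
    (by
      have : A * (RatFunc.X - RatFunc.X⁻¹) = (RatFunc.C d₀ + RatFunc.C d₁ * RatFunc.X⁻¹)
          * (phi P RatFunc.X * (Zp - bigZ P) * (RatFunc.X - RatFunc.X⁻¹)) := by
        rw [hA']; ring
      rw [this, hA]
      simp only [gCoeff, Int.reduceSub, Int.reduceNeg, f3, f3', map_add, map_mul, map_zero]
      field_simp
      ring)
    (by
      have : B * (RatFunc.X⁻¹ - RatFunc.X) = (RatFunc.C d₀ + RatFunc.C d₁ * RatFunc.X)
          * (phi P RatFunc.X⁻¹ * (Zm - bigZ P) * (RatFunc.X⁻¹ - RatFunc.X)) := by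
        rw [hB']; ring
      rw [this, hB]
      simp only [gCoeff, Int.reduceSub, Int.reduceNeg, f3, f3', map_add, map_mul, map_zero]
      field_simp
      ring)
  rw [hZ] at hsym
  have hE : A + B = RatFunc.C (opConst P) * aeval (bigZ P) (gEvenPoly P d₀ d₁) := by
    rw [hsym.1]
    simp [gEvenPoly, RatFunc.algebraMap_eq_C]
  have hO : A * (RatFunc.X - RatFunc.X⁻¹) + B * (RatFunc.X⁻¹ - RatFunc.X) =
      RatFunc.C (opConst P) * aeval (bigZ P) (gOddPoly P d₀ d₁) := by
    rw [hsym.2]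
    simp [gOddPoly, map_ofNat, RatFunc.algebraMap_eq_C]
  have hd : (RatFunc.C P.q - (RatFunc.C P.q)⁻¹) ^ 2 * (RatFunc.C P.q + (RatFunc.C P.q)⁻¹) ^ 2 =
      (RatFunc.C P.q ^ 2 + (RatFunc.C P.q ^ 2)⁻¹) ^ 2 - 4 := by
    field_simp; ring
  -- Square `hp` after isolating `z - z⁻¹`, then replace `(z - z⁻¹)²` by its expression in `Z`.
  have hcp : Zp ^ 2 = (RatFunc.C P.q ^ 2 + (RatFunc.C P.q ^ 2)⁻¹) * bigZ P * Zp
      - (bigZ P ^ 2 + (RatFunc.C P.q - (RatFunc.C P.q)⁻¹) ^ 2) := by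
    linear_combination (2 * Zp - (RatFunc.C P.q ^ 2 + (RatFunc.C P.q ^ 2)⁻¹) * bigZ P
      + (RatFunc.C P.q - (RatFunc.C P.q)⁻¹) * (RatFunc.X - RatFunc.X⁻¹)) / 4 * hp
      + (RatFunc.C P.q - (RatFunc.C P.q)⁻¹) ^ 2 / 4 * hquad + bigZ P ^ 2 / 4 * hd
  have hcm : Zm ^ 2 = (RatFunc.C P.q ^ 2 + (RatFunc.C P.q ^ 2)⁻¹) * bigZ P * Zm
      - (bigZ P ^ 2 + (RatFunc.C P.q - (RatFunc.C P.q)⁻¹) ^ 2) := by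
    linear_combination (2 * Zm - (RatFunc.C P.q ^ 2 + (RatFunc.C P.q ^ 2)⁻¹) * bigZ P
      - (RatFunc.C P.q - (RatFunc.C P.q)⁻¹) * (RatFunc.X - RatFunc.X⁻¹)) / 4 * hm
      + (RatFunc.C P.q - (RatFunc.C P.q)⁻¹) ^ 2 / 4 * hquad + bigZ P ^ 2 / 4 * hd
  induction n using Nat.twoStepInduction with
  | zero => simpa [shiftPoly] using hE
  | one =>
    simp only [shiftPoly, map_mul, map_add, aeval_C, aeval_X, RatFunc.algebraMap_eq_C, map_sub,
      map_inv₀, map_pow, map_div₀, map_one, map_ofNat, pow_one]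
    linear_combination A / 2 * hp + B / 2 * hm
      + (RatFunc.C P.q ^ 2 + (RatFunc.C P.q ^ 2)⁻¹) / 2 * bigZ P * hE
      + (RatFunc.C P.q - (RatFunc.C P.q)⁻¹) / 2 * hO
  | more n ih1 ih2 =>
    simp only [shiftPoly, map_mul, map_add, aeval_C, aeval_X, RatFunc.algebraMap_eq_C, map_sub,
      map_inv₀, map_pow]
    linear_combination A * Zp ^ n * hcp + B * Zm ^ n * hcm
      + (RatFunc.C P.q ^ 2 + (RatFunc.C P.q ^ 2)⁻¹) * bigZ P * ih2
      - (bigZ P ^ 2 + (RatFunc.C P.q - (RatFunc.C P.q)⁻¹) ^ 2) * ih1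

/-- On monomials this is the telescoping `Z₊^(n+1) - Z^(n+1) = Z (Z₊ⁿ - Zⁿ) + (Z₊ - Z) Z₊ⁿ`, matched
with the recursion of `diffPoly`; the last term is supplied by `shift_identity`. -/
theorem diff_identity (P : Params) (d₀ d₁ : ℂ) (p : ℂ[X]) :
    phi P RatFunc.X * (RatFunc.C d₀ + RatFunc.C d₁ * RatFunc.X⁻¹)
        * (Tplus P (aeval (bigZ P) p) - aeval (bigZ P) p)
      + phi P RatFunc.X⁻¹ * (RatFunc.C d₀ + RatFunc.C d₁ * RatFunc.X)
        * (Tminus P (aeval (bigZ P) p) - aeval (bigZ P) p) =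
    RatFunc.C (opConst P) * aeval (bigZ P) (diffMap P d₀ d₁ p) := by
  induction p using Polynomial.induction_on' with
  | add p r hp hr =>
    simp only [map_add]
    linear_combination hp + hr
  | monomial n a =>
    have key : phi P RatFunc.X * (RatFunc.C d₀ + RatFunc.C d₁ * RatFunc.X⁻¹)
        * (Tplus P (bigZ P) ^ n - bigZ P ^ n)
      + phi P RatFunc.X⁻¹ * (RatFunc.C d₀ + RatFunc.C d₁ * RatFunc.X)
        * (Tminus P (bigZ P) ^ n - bigZ P ^ n) =
        RatFunc.C (opConst P) * aeval (bigZ P) (diffPoly P d₀ d₁ n) := by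
      induction n with
      | zero => simp [diffPoly]
      | succ n ih =>
        simp only [diffPoly, map_add, map_mul, aeval_X]
        linear_combination bigZ P * ih + shift_identity P d₀ d₁ n
    rw [diffMap_monomial, map_smul, aeval_monomial, Algebra.smul_def]
    simp only [map_mul, map_pow, AlgHom.commutes]
    linear_combination algebraMap ℂ (RatFunc ℂ) a * key

/-- The multiplication term of `d₀ π(A*) + q d₁ π(A)`, as a polynomial in `Z`. -/
def multPoly (P : Params) (d₀ d₁ : ℂ) : ℂ[X] :=
  C (d₀ * (1 / 2 * P.qNu * (Complex.exp P.muP * (P.q ^ P.twoS)⁻¹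
        + Complex.exp (-P.muP) * P.q ^ P.twoS))
    + P.q * d₁ * (1 / 2 * P.qNu * Complex.exp (-P.muP) * P.q ^ P.twoS)
      * (2 * Complex.exp P.muP * Complex.cosh P.mu
        - (P.v ^ 2 + (P.v ^ 2)⁻¹) * (P.q ^ (P.twoS + 1))⁻¹))
  + C (d₁ * (1 / 2 * P.qNu * Complex.exp (-P.muP) * P.q ^ P.twoS) * (P.q + P.q⁻¹)) * X

/-- On polynomials in `Z`, the operator `d₀ π(A*) + q d₁ π(A)` is given by a linear map on `ℂ[X]`. -/
theorem op_aeval (P : Params) (d₀ d₁ : ℂ) (p : ℂ[X]) :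
    d₀ • opAStar P (aeval (bigZ P) p) + (P.q * d₁) • opA P (aeval (bigZ P) p) =
      aeval (bigZ P) (C (opConst P) * diffMap P d₀ d₁ p + multPoly P d₀ d₁ * p) := by
  have hq := (den_ne P).1
  have hs := ratFuncC_q_add_inv_ne P
  have hZ : (RatFunc.C P.q + (RatFunc.C P.q)⁻¹) * bigZ P = RatFunc.X + RatFunc.X⁻¹ := by
    rw [bigZ_eq_zAt, zAt, mul_div_cancel₀ _ hs]
  have hmult : aeval (bigZ P) (multPoly P d₀ d₁) =
      RatFunc.C d₀ * RatFunc.C (1 / 2 * P.qNu * (Complex.exp P.muP * (P.q ^ P.twoS)⁻¹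
        + Complex.exp (-P.muP) * P.q ^ P.twoS))
      + RatFunc.C P.q * RatFunc.C d₁ * multA P := by
    have hqi : RatFunc.C P.q * RatFunc.C P.q⁻¹ = 1 := by rw [map_inv₀, mul_inv_cancel₀ hq]
    rw [multPoly, multA, ← hZ]
    simp only [map_add, map_mul, aeval_C, aeval_X, RatFunc.algebraMap_eq_C, map_inv₀] at hqi ⊢
    linear_combination (-RatFunc.C d₁ * (RatFunc.C (1 / 2) * RatFunc.C P.qNu
      * RatFunc.C (Complex.exp (-P.muP)) * RatFunc.C (P.q ^ P.twoS))
      * (RatFunc.C P.q + (RatFunc.C P.q)⁻¹) * bigZ P) * hqi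
  have h := diff_identity P d₀ d₁ p
  rw [map_add, map_mul, map_mul, hmult, aeval_C, RatFunc.algebraMap_eq_C, ← h, opAStar_apply,
    opA_apply, Algebra.smul_def, Algebra.smul_def, RatFunc.algebraMap_eq_C, scal_eq, map_mul]
  -- The factor `q` in `q d₁ π(A)` is there to absorb the `q⁻¹` in front of `z^{±1} φ`.
  have hi : RatFunc.C P.q * (RatFunc.C P.q)⁻¹ = 1 := mul_inv_cancel₀ hq
  linear_combination RatFunc.C d₁ * (RatFunc.X⁻¹ * phi P RatFunc.X
      * (Tplus P (aeval (bigZ P) p) - aeval (bigZ P) p)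
    + RatFunc.X * phi P RatFunc.X⁻¹ * (Tminus P (aeval (bigZ P) p) - aeval (bigZ P) p)) * hi

/-! ### Leading coefficients -/

/-- `p` has degree at most `n + 1`, and its coefficients of `X^(n+1)` and `X^n` are `a`, `b`. -/
def HasTop (p : ℂ[X]) (n : ℕ) (a b : ℂ) : Prop :=
  (∀ k, n + 1 < k → p.coeff k = 0) ∧ p.coeff (n + 1) = a ∧ p.coeff n = b

namespace HasTop

variable {p r : ℂ[X]} {n : ℕ} {a b a' b' : ℂ}

theorem add (hp : HasTop p n a b) (hr : HasTop r n a' b') : HasTop (p + r) n (a + a') (b + b') := by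
  refine ⟨fun k hk => ?_, ?_, ?_⟩
  · rw [coeff_add, hp.1 k hk, hr.1 k hk, add_zero]
  · rw [coeff_add, hp.2.1, hr.2.1]
  · rw [coeff_add, hp.2.2, hr.2.2]

theorem C_mul (hp : HasTop p n a b) (c : ℂ) : HasTop (C c * p) n (c * a) (c * b) := by
  refine ⟨fun k hk => ?_, ?_, ?_⟩
  · rw [coeff_C_mul, hp.1 k hk, mul_zero]
  · rw [coeff_C_mul, hp.2.1]
  · rw [coeff_C_mul, hp.2.2]

theorem sub (hp : HasTop p n a b) (hr : HasTop r n a' b') : HasTop (p - r) n (a - a') (b - b') := by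
  refine ⟨fun k hk => ?_, ?_, ?_⟩
  · rw [coeff_sub, hp.1 k hk, hr.1 k hk, sub_zero]
  · rw [coeff_sub, hp.2.1, hr.2.1]
  · rw [coeff_sub, hp.2.2, hr.2.2]

theorem X_mul (hp : HasTop p n a b) : HasTop (X * p) (n + 1) a b := by
  refine ⟨fun k hk => ?_, ?_, ?_⟩
  · obtain ⟨k, rfl⟩ : ∃ j, k = j + 1 := ⟨k - 1, by omega⟩
    rw [coeff_X_mul, hp.1 k (by omega)]
  · rw [coeff_X_mul, hp.2.1]
  · rw [coeff_X_mul, hp.2.2]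

theorem raise (hp : HasTop p n a b) : HasTop p (n + 1) 0 a :=
  ⟨fun k hk => hp.1 k (by omega), hp.1 _ (by omega), hp.2.1⟩

theorem congr (hp : HasTop p n a b) (ha : a = a') (hb : b = b') : HasTop p n a' b' :=
  ha ▸ hb ▸ hp

end HasTop

theorem gEvenPoly_hasTop (P : Params) (d₀ d₁ : ℂ) :
    HasTop (gEvenPoly P d₀ d₁) 1 (-(gCoeff P d₀ d₁ 3 * (P.q + P.q⁻¹) ^ 2))
      (-((gCoeff P d₀ d₁ 2 - gCoeff P d₀ d₁ (-2)) * (P.q + P.q⁻¹))) := by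
  have e : gEvenPoly P d₀ d₁ =
      C (-(gCoeff P d₀ d₁ 3 * (P.q + P.q⁻¹) ^ 2)) * X ^ 2
      + C (-((gCoeff P d₀ d₁ 2 - gCoeff P d₀ d₁ (-2)) * (P.q + P.q⁻¹))) * X ^ 1
      + C (gCoeff P d₀ d₁ 3 - (gCoeff P d₀ d₁ 1 - gCoeff P d₀ d₁ (-1))) := by
    simp only [gEvenPoly, C_neg, C_mul, C_sub, C_pow]
    ring
  rw [e]
  refine ⟨fun k hk => ?_, ?_, ?_⟩
  · simp only [coeff_add, coeff_C_mul, coeff_X_pow, coeff_C]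
    rw [if_neg (by omega), if_neg (by omega), if_neg (by omega)]
    ring
  · simp only [coeff_add, coeff_C_mul, coeff_X_pow, coeff_C]
    norm_num
  · simp only [coeff_add, coeff_C_mul, coeff_X_pow, coeff_C]
    norm_num

theorem gOddPoly_hasTop (P : Params) (d₀ d₁ : ℂ) :
    HasTop (gOddPoly P d₀ d₁) 2 (gCoeff P d₀ d₁ 3 * (P.q + P.q⁻¹) ^ 3)
      ((gCoeff P d₀ d₁ 2 + gCoeff P d₀ d₁ (-2)) * (P.q + P.q⁻¹) ^ 2) := by
  have e : gOddPoly P d₀ d₁ =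
      C (gCoeff P d₀ d₁ 3 * (P.q + P.q⁻¹) ^ 3) * X ^ 3
      + C ((gCoeff P d₀ d₁ 2 + gCoeff P d₀ d₁ (-2)) * (P.q + P.q⁻¹) ^ 2) * X ^ 2
      + C ((gCoeff P d₀ d₁ 1 + gCoeff P d₀ d₁ (-1) - 3 * gCoeff P d₀ d₁ 3) * (P.q + P.q⁻¹)) * X ^ 1
      + C (2 * gCoeff P d₀ d₁ 0 - 2 * (gCoeff P d₀ d₁ 2 + gCoeff P d₀ d₁ (-2))) := by
    have c2 : (C 2 : ℂ[X]) = 2 := map_ofNat _ 2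
    have c3 : (C 3 : ℂ[X]) = 3 := map_ofNat _ 3
    simp only [gOddPoly, C_mul, C_sub, C_pow, C_add, c2, c3]
    ring
  rw [e]
  refine ⟨fun k hk => ?_, ?_, ?_⟩
  · simp only [coeff_add, coeff_C_mul, coeff_X_pow, coeff_C]
    rw [if_neg (by omega), if_neg (by omega), if_neg (by omega), if_neg (by omega)]
    ring
  · simp only [coeff_add, coeff_C_mul, coeff_X_pow, coeff_C]
    norm_num
  · simp only [coeff_add, coeff_C_mul, coeff_X_pow, coeff_C]
    norm_num

/-- On the two leading coefficients the recursion becomes `x_{n+2} = (q² + q⁻²) x_{n+1} - x_n`, with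
characteristic roots `q²` and `q⁻²`; the summand `(q - q⁻¹)²` lies two degrees lower and does not
contribute. -/
theorem shiftPoly_hasTop (P : Params) (d₀ d₁ : ℂ) (n : ℕ) :
    HasTop (shiftPoly P d₀ d₁ n) (n + 1)
      (-((P.q + P.q⁻¹) ^ 2 * gCoeff P d₀ d₁ 3 * ((P.q ^ 2)⁻¹) ^ n))
      ((P.q + P.q⁻¹) * (gCoeff P d₀ d₁ (-2) * (P.q ^ 2) ^ n
        - gCoeff P d₀ d₁ 2 * ((P.q ^ 2)⁻¹) ^ n)) := by
  have hq := P.q_ne_zero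
  induction n using Nat.twoStepInduction with
  | zero =>
    exact (gEvenPoly_hasTop P d₀ d₁).congr (by ring) (by ring)
  | one =>
    rw [shiftPoly, mul_assoc (C _) X]
    refine ((((gEvenPoly_hasTop P d₀ d₁).X_mul.C_mul _).add
      ((gOddPoly_hasTop P d₀ d₁).C_mul _)).C_mul _).congr ?_ ?_
    · field_simp; ring
    · field_simp; ring
  | more n ih1 ih2 =>
    rw [shiftPoly, mul_assoc (C _) X, add_mul, pow_two (X : ℂ[X]), mul_assoc X]
    refine ((ih2.X_mul.C_mul _).sub (ih1.X_mul.X_mul.add (ih1.raise.raise.C_mul _))).congr ?_ ?_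
    · simp only [inv_pow, pow_succ _ n, pow_succ _ (n + 1)]
      field_simp
      ring
    · simp only [inv_pow, pow_succ _ n, pow_succ _ (n + 1)]
      field_simp
      ring

theorem diffPoly_hasTop (P : Params) (d₀ d₁ : ℂ) (n : ℕ) :
    HasTop (diffPoly P d₀ d₁ n) n
      (-((P.q + P.q⁻¹) ^ 2 * gCoeff P d₀ d₁ 3 * ∑ a ∈ Finset.range n, ((P.q ^ 2)⁻¹) ^ a))
      ((P.q + P.q⁻¹) * (gCoeff P d₀ d₁ (-2) * ∑ a ∈ Finset.range n, (P.q ^ 2) ^ a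
        - gCoeff P d₀ d₁ 2 * ∑ a ∈ Finset.range n, ((P.q ^ 2)⁻¹) ^ a)) := by
  induction n with
  | zero => simp [diffPoly, HasTop]
  | succ n ih =>
    rw [diffPoly]
    refine (ih.X_mul.add (shiftPoly_hasTop P d₀ d₁ n)).congr ?_ ?_
    · rw [Finset.sum_range_succ]; ring
    · rw [Finset.sum_range_succ, Finset.sum_range_succ]; ring

theorem coeff_diffMap_eq_zero (P : Params) (d₀ d₁ : ℂ) (p : ℂ[X]) (m : ℕ)
    (hp : ∀ k, m ≤ k → p.coeff k = 0) (k : ℕ) (hk : m < k) :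
    (diffMap P d₀ d₁ p).coeff k = 0 := by
  rw [diffMap, Polynomial.lsum_apply, Polynomial.sum, finsetSum_coeff]
  refine Finset.sum_eq_zero fun n hn => ?_
  have hn' : n < m := by
    by_contra h
    exact mem_support_iff.1 hn (hp n (not_lt.1 h))
  rw [LinearMap.toSpanSingleton_apply, coeff_smul,
    (diffPoly_hasTop P d₀ d₁ n).1 k (by omega), smul_zero]

/-- The window is `M + 1, M` although the degree is `M`, because the operator can raise the degree
by one. -/
theorem prod_X_sub_C_hasTop {M : ℕ} (U : Fin M → ℂ) : HasTop (∏ j, (X - C (U j))) M 0 1 := by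
  have hd : (∏ j, (X - C (U j))).natDegree = M := by
    rw [natDegree_finsetProd_X_sub_C_eq_card]; simp
  have hm : (∏ j, (X - C (U j))).Monic := monic_prod_X_sub_C _ _
  refine ⟨fun k hk => coeff_eq_zero_of_natDegree_lt (by omega),
    coeff_eq_zero_of_natDegree_lt (by omega), ?_⟩
  have := hm.coeff_natDegree
  rwa [hd] at this

theorem X_mul_prod_X_sub_C_hasTop {M : ℕ} (U : Fin M → ℂ) :
    HasTop (X * ∏ j, (X - C (U j))) M 1 (-∑ j, U j) := by
  have h := prod_X_sub_C_hasTop U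
  refine ⟨fun k hk => ?_, ?_, ?_⟩
  · obtain ⟨k, rfl⟩ : ∃ j, k = j + 1 := ⟨k - 1, by omega⟩
    rw [coeff_X_mul]
    rcases eq_or_lt_of_le (Nat.le_of_lt_succ hk) with h' | h'
    · rw [← h', h.2.1]
    · exact h.1 k h'
  · rw [coeff_X_mul, h.2.2]
  · cases M with
    | zero => simp
    | succ m =>
      rw [coeff_X_mul]
      have := prod_X_sub_C_coeff_card_pred (Finset.univ : Finset (Fin (m + 1))) U (by simp)
      simpa using this

/-- `diffMap` raises degrees by at most one, so only `X^M` and `-(∑ U_j) X^(M-1)` reach the window.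
The factor `q² (∑ - 1)` is the geometric sum over `a < M - 1`, written so as to make sense without
`M - 1`; for `M = 0` it is multiplied by an empty sum. -/
theorem diffMap_prod_hasTop (P : Params) (d₀ d₁ : ℂ) {M : ℕ} (U : Fin M → ℂ) :
    HasTop (diffMap P d₀ d₁ (∏ j, (X - C (U j)))) M
      (-((P.q + P.q⁻¹) ^ 2 * gCoeff P d₀ d₁ 3 * ∑ a ∈ Finset.range M, ((P.q ^ 2)⁻¹) ^ a))
      ((P.q + P.q⁻¹) * (gCoeff P d₀ d₁ (-2) * ∑ a ∈ Finset.range M, (P.q ^ 2) ^ a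
          - gCoeff P d₀ d₁ 2 * ∑ a ∈ Finset.range M, ((P.q ^ 2)⁻¹) ^ a)
        + (∑ j, U j) * ((P.q + P.q⁻¹) ^ 2 * gCoeff P d₀ d₁ 3
          * (P.q ^ 2 * (∑ a ∈ Finset.range M, ((P.q ^ 2)⁻¹) ^ a - 1)))) := by
  have hq := P.q_ne_zero
  cases M with
  | zero =>
    have h := diffMap_monomial P d₀ d₁ 0 1
    rw [monomial_zero_left, C_1, one_smul] at h
    simpa [h] using diffPoly_hasTop P d₀ d₁ 0
  | succ m =>
    set p : ℂ[X] := ∏ j, (X - C (U j)) with hp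
    set r : ℂ[X] := p - (monomial (m + 1) 1 + monomial m (-∑ j, U j)) with hr
    have e : p = monomial (m + 1) 1 + monomial m (-∑ j, U j) + r := by rw [hr]; ring
    have hr0 : ∀ k, m ≤ k → r.coeff k = 0 := by
      intro k hk
      have h1 := prod_X_sub_C_hasTop U
      have h2 := (X_mul_prod_X_sub_C_hasTop U).2.2
      rw [coeff_X_mul] at h2
      rw [hr, coeff_sub, coeff_add, coeff_monomial, coeff_monomial]
      rcases lt_trichotomy k (m + 1) with h | h | h
      · obtain rfl : k = m := by omega
        rw [if_neg (by omega), if_pos rfl, h2]; ring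
      · subst h
        rw [if_pos rfl, if_neg (by omega), h1.2.2]; ring
      · rw [if_neg (by omega), if_neg (by omega)]
        rcases eq_or_lt_of_le (Nat.succ_le_of_lt h) with h' | h'
        · rw [← h', h1.2.1]; ring
        · rw [h1.1 k h']; ring
    have hz := coeff_diffMap_eq_zero P d₀ d₁ r m hr0
    have hrt : HasTop (diffMap P d₀ d₁ r) (m + 1) 0 0 :=
      ⟨fun k hk => hz k (by omega), hz _ (by omega), hz _ (by omega)⟩
    rw [e, map_add, map_add, diffMap_monomial, diffMap_monomial, one_smul, smul_eq_C_mul]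
    refine (((diffPoly_hasTop P d₀ d₁ (m + 1)).add
      ((diffPoly_hasTop P d₀ d₁ m).raise.C_mul _)).add hrt).congr (by ring) ?_
    have hG : P.q ^ 2 * (∑ a ∈ Finset.range (m + 1), ((P.q ^ 2)⁻¹) ^ a - 1) =
        ∑ a ∈ Finset.range m, ((P.q ^ 2)⁻¹) ^ a := by
      rw [Finset.sum_range_succ', pow_zero, add_sub_cancel_right, Finset.mul_sum]
      refine Finset.sum_congr rfl fun a _ => ?_
      rw [pow_succ' _ a, mul_inv_cancel_left₀ (pow_ne_zero 2 hq)]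
    rw [hG]
    ring

theorem hPoly_hasTop (P : Params) :
    HasTop (hPoly P) P.twoS ((P.q + P.q⁻¹) ^ (P.twoS + 1))
      (-((P.q + P.q⁻¹) ^ (P.twoS + 1) * ∑ k : Fin (P.twoS + 1), Xk P k)) := by
  have e : hPoly P = C ((P.q + P.q⁻¹) ^ (P.twoS + 1)) *
      ∏ k : Fin (P.twoS + 1), (X - C (Xk P k)) := by
    have h := Multiset.prod_X_sub_X_eq_sum_esymm ((Multiset.range (P.twoS + 1)).map (Xk P))
    rw [Multiset.map_map] at h
    rw [hPoly, Fin.prod_univ_eq_prod_range (fun k => X - C (Xk P k)),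
      Finset.prod_eq_multiset_prod]
    congr 1
    refine Eq.trans ?_ h.symm
    refine Finset.sum_congr (by simp) fun k _ => ?_
    simp [mul_assoc]
  have h1 := prod_X_sub_C_hasTop fun k : Fin (P.twoS + 1) => Xk P k
  have h2 := (X_mul_prod_X_sub_C_hasTop fun k : Fin (P.twoS + 1) => Xk P k).2.2
  rw [coeff_X_mul] at h2
  have h3 : HasTop (∏ k : Fin (P.twoS + 1), (X - C (Xk P k))) P.twoS 1
      (-∑ k : Fin (P.twoS + 1), Xk P k) := by
    refine ⟨fun k hk => ?_, h1.2.2, h2⟩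
    rcases eq_or_lt_of_le (Nat.succ_le_of_lt hk) with h' | h'
    · rw [← h', h1.2.1]
    · exact h1.1 k h'
  rw [e]
  exact (h3.C_mul _).congr (by ring) (by ring)

/-! ### From Bethe roots to eigenvalue equations -/

theorem eq_zero_of_hasTop {M : ℕ} (U : Fin M → ℂ) (hU : Function.Injective U) (p : ℂ[X])
    (hp : HasTop p M 0 0) (h : ∀ i, p.eval (U i) = 0) : p = 0 := by
  refine eq_zero_of_degree_lt_of_eval_index_eq_zero Finset.univ hU.injOn ?_
    fun i _ => h i
  rw [Finset.card_univ, Fintype.card_fin, degree_lt_iff_coeff_zero]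
  intro k hk
  rcases lt_trichotomy k (M + 1) with h | h | h
  · obtain rfl : k = M := by omega
    exact hp.2.2
  · rw [h, hp.2.1]
  · exact hp.1 k h

theorem aeval_prod_eq_qFun (P : Params) {M : ℕ} (U : Fin M → ℂ) :
    aeval (bigZ P) (∏ j, (X - C (U j))) = qFun P U := by
  simp [qFun, map_prod, RatFunc.algebraMap_eq_C]

/-- The Bethe equations imply the (inhomogeneous) eigenvalue equation as soon as the two leading
coefficients match. -/
theorem op_qFun (P : Params) (d₀ d₁ dbar c Λ : ℂ) {M : ℕ} (U : Fin M → ℂ)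
    (hU : Function.Injective U) (hB : ∀ i, bethePoly P d₀ d₁ dbar U i = 0)
    (hc : 0 < M → c * (P.q + P.q⁻¹) ^ (M - 1) = opConst P * dbar)
    (htop : HasTop (C (opConst P) * diffMap P d₀ d₁ (∏ j, (X - C (U j)))
      + multPoly P d₀ d₁ * ∏ j, (X - C (U j)) - C Λ * ∏ j, (X - C (U j)) + C c * hPoly P) M 0 0) :
    d₀ • opAStar P (qFun P U) + (P.q * d₁) • opA P (qFun P U) =
      Λ • qFun P U - c • hFun P := by
  have hs := q_add_inv_ne P
  -- At `U i` every multiple of `Q` drops out, and what remains is proportional to the Bethe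
  -- polynomial. The relation `hc` between `c` and `dbar` is needed only when there is a root, that
  -- is for `M > 0`.
  have h0 := eq_zero_of_hasTop U hU _ htop fun i => by
    have hQ : (∏ j, (X - C (U j))).eval (U i) = 0 := by
      rw [eval_prod]
      exact Finset.prod_eq_zero (Finset.mem_univ i) (by simp)
    have hb := hB i
    rw [bethePoly_eq] at hb
    simp only [eval_add, eval_sub, eval_mul, eval_C, hQ, mul_zero, add_zero, sub_zero]
    apply mul_left_cancel₀ (pow_ne_zero (M - 1) hs)
    linear_combination opConst P * hb + (hPoly P).eval (U i) * hc (Fin.pos i)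
  rw [← aeval_prod_eq_qFun, op_aeval, hFun, ← map_smul, ← map_smul, ← map_sub,
    smul_eq_C_mul, smul_eq_C_mul]
  congr 1
  linear_combination h0

/-! ### Geometric sums in `q²` -/

theorem q_sq_sub_one_ne (P : Params) : P.q ^ 2 - 1 ≠ 0 :=
  sub_ne_zero.2 (P.q_pow_ne_one 2 (by norm_num))

theorem sum_q_sq_pow (P : Params) (n : ℕ) :
    ∑ a ∈ Finset.range n, (P.q ^ 2) ^ a = ((P.q ^ n) ^ 2 - 1) / (P.q ^ 2 - 1) := by
  rw [geom_sum_eq (P.q_pow_ne_one 2 (by norm_num)), ← pow_mul, ← pow_mul, mul_comm]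

theorem sum_q_sq_inv_pow (P : Params) (n : ℕ) :
    ∑ a ∈ Finset.range n, ((P.q ^ 2)⁻¹) ^ a =
      P.q ^ 2 * (1 - ((P.q ^ n) ^ 2)⁻¹) / (P.q ^ 2 - 1) := by
  have hq := P.q_ne_zero
  have h := q_sq_sub_one_ne P
  rw [eq_div_iff h]
  induction n with
  | zero => simp
  | succ n ih =>
    rw [Finset.sum_range_succ, add_mul, ih, pow_succ _ n, inv_pow, pow_right_comm _ 2 n]
    field_simp
    ring

theorem sum_Xk (P : Params) :
    (P.q + P.q⁻¹) * ∑ k : Fin (P.twoS + 1), Xk P k =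
      (P.v ^ 2 + (P.v ^ 2)⁻¹) *
        ((P.q ^ P.twoS * P.q) ^ 2 - 1) / (P.q ^ P.twoS * (P.q ^ 2 - 1)) := by
  have hq := P.q_ne_zero
  have hs := q_add_inv_ne P
  have h2 := q_sq_sub_one_ne P
  have hv := P.v_ne_zero
  rw [Fin.sum_univ_eq_sum_range (Xk P), Finset.mul_sum]
  have e : ∀ k : ℕ, (P.q + P.q⁻¹) * Xk P k =
      (P.q ^ P.twoS)⁻¹ * P.v ^ 2 * (P.q ^ 2) ^ k
        + P.q ^ P.twoS * (P.v ^ 2)⁻¹ * ((P.q ^ 2)⁻¹) ^ k := by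
    intro k
    rw [Xk, mul_div_cancel₀ _ hs, zpow_sub₀ hq, zpow_sub₀ hq, zpow_mul, zpow_natCast, zpow_natCast,
      inv_pow]
    norm_cast
    field_simp
  simp only [e]
  rw [Finset.sum_add_distrib, ← Finset.mul_sum, ← Finset.mul_sum, sum_q_sq_pow, sum_q_sq_inv_pow,
    pow_succ _ P.twoS]
  field_simp

/-! ### Matching the leading coefficients in the two cases -/

theorem opAStar_qFun (P : Params) {M : ℕ} (U : Fin M → ℂ) (h : IsBetheSp P U) :
    opAStar P (qFun P U) = eigSp P 1 M • qFun P U := by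
  have hq := P.q_ne_zero
  have hs := q_add_inv_ne P
  have hs' : P.q + P.q⁻¹ = (P.q ^ 2 + 1) / P.q := by field_simp
  have hs2 : P.q ^ 2 + 1 ≠ 0 := fun h0 => hs (by rw [hs', h0, zero_div])
  have h2 := q_sq_sub_one_ne P
  have hE := Complex.exp_ne_zero P.muP
  have hop := op_qFun P 1 0 0 0 (eigSp P 1 M) U h.1 h.2 (by simp) (by
    have hm : multPoly P 1 0 = C (1 / 2 * P.qNu * (Complex.exp P.muP * (P.q ^ P.twoS)⁻¹
        + Complex.exp (-P.muP) * P.q ^ P.twoS)) := by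
      simp [multPoly]
    rw [hm, C_0, zero_mul, add_zero]
    have hQ := prod_X_sub_C_hasTop U
    refine ((((diffMap_prod_hasTop P 1 0 U).C_mul _).add (hQ.C_mul _)).sub (hQ.C_mul _)).congr ?_ ?_
    -- With `d₁ = 0` the Laurent polynomial `G` stops at `z²`, so the degree is not raised and no
    -- inhomogeneous term is needed.
    · simp [gCoeff, show fCoeff P 3 = 0 from rfl]
    · rw [sum_q_sq_pow, sum_q_sq_inv_pow, eigSp, zpow_sub₀ hq, zpow_add₀ hq, zpow_neg,
        zpow_natCast, mul_comm 2 (M : ℤ), zpow_mul, zpow_natCast]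
      simp only [gCoeff, opConst, fCoeff, Complex.exp_neg, hs']
      norm_cast
      field_simp
      ring)
  simpa using hop

theorem opD_qFun (P : Params) (κ κs : ℂ) (U : Fin P.twoS → ℂ) (h : IsBetheD P κ κs U) :
    κs • opAStar P (qFun P U) + κ • opA P (qFun P U) =
      eigD P κ κs U • qFun P U
        - (κ * P.q * deltaD P * ((-1) ^ (P.twoS + 1) / (P.q + P.q⁻¹) ^ P.twoS)) • hFun P := by
  have hq := P.q_ne_zero
  have hs := q_add_inv_ne P
  have hs' : P.q + P.q⁻¹ = (P.q ^ 2 + 1) / P.q := by field_simp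
  have hs2 : P.q ^ 2 + 1 ≠ 0 := fun h0 => hs (by rw [hs', h0, zero_div])
  have h2 := q_sq_sub_one_ne P
  have hE := Complex.exp_ne_zero P.muP
  have hv := P.v_ne_zero
  have hsgn : ((-1 : ℂ) ^ P.twoS) * (-1) ^ P.twoS = 1 := by
    rw [← mul_pow]; simp
  have hN : P.qNu ≠ 0 := by
    unfold Params.qNu; simp [Complex.cpow_eq_zero_iff, hq]
  have hqq : P.q - P.q⁻¹ ≠ 0 := by
    intro h; apply h2; field_simp at h; linear_combination h
  have hκ : P.q * (κ * P.q⁻¹) = κ := by field_simp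
  have hop := op_qFun P κs (κ * P.q⁻¹) (deltaBarD P κ)
    (κ * P.q * deltaD P * ((-1) ^ (P.twoS + 1) / (P.q + P.q⁻¹) ^ P.twoS)) (eigD P κ κs U) U h.1 h.2
    (by
      intro hM
      obtain ⟨n, hn⟩ : ∃ n, P.twoS = n + 1 := ⟨P.twoS - 1, by omega⟩
      rw [opConst, deltaBarD]
      rw [hn, Nat.add_sub_cancel, pow_succ (P.q + P.q⁻¹)]
      generalize deltaD P = δ
      generalize P.q + P.q⁻¹ = s at *
      generalize P.q - P.q⁻¹ = t at *
      field_simp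
      ring)
    (by
      -- This is the leading coefficient of `c H`. The sign in `δ_d` cancels the sign in `c`, since
      -- `(-1)^{2s}` squares to one.
      have hc : κ * P.q * deltaD P * ((-1) ^ (P.twoS + 1) / (P.q + P.q⁻¹) ^ P.twoS)
          * (P.q + P.q⁻¹) ^ (P.twoS + 1) =
          -(κ / 2 * Complex.exp (-P.muP) * P.qNu * (P.q ^ P.twoS)⁻¹ * P.q⁻¹ * (P.q + P.q⁻¹)) := by
        have hsn : (P.q + P.q⁻¹) ^ (P.twoS + 1) =
            (P.q + P.q⁻¹) ^ P.twoS * (P.q + P.q⁻¹) := pow_succ _ _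
        have hsn0 := pow_ne_zero P.twoS hs
        rw [hsn, deltaD, pow_succ (-1 : ℂ), pow_succ P.q, pow_succ P.q]
        generalize (P.q + P.q⁻¹) ^ P.twoS = sn at *
        generalize (-1 : ℂ) ^ P.twoS = e at *
        generalize P.q + P.q⁻¹ = s at *
        field_simp
        linear_combination -κ * hsgn
      have hQ := prod_X_sub_C_hasTop U
      have hXQ := X_mul_prod_X_sub_C_hasTop U
      rw [multPoly, add_mul (C _), mul_assoc (C _) X]
      refine (((((diffMap_prod_hasTop P κs (κ * P.q⁻¹) U).C_mul _).add ((hQ.C_mul _).add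
        (hXQ.C_mul _))).sub (hQ.C_mul _)).add ((hPoly_hasTop P).C_mul _)).congr ?_ ?_
      -- Coefficient of `X^(2s+1)`: the geometric sum in `diffMap` contributes a multiple of
      -- `q^{-2s} - q^{2s}`, the multiplication term cancels its `q^{2s}`, and `c H` cancels the
      -- remaining `q^{-2s}`.
      · rw [hc, sum_q_sq_inv_pow]
        simp only [gCoeff, Int.reduceSub, opConst, fCoeff, Complex.exp_neg, hs']
        field_simp
        ring
      -- Coefficient of `X^(2s)`: this equation determines `Λ_d`. The sum of the `X_k` comes from
      -- the second coefficient of `H`, and the sum of the roots from `diffMap Q` and from the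
      -- linear part of `multPoly`.
      · rw [mul_neg _ (_ * ∑ k : Fin (P.twoS + 1), Xk P k),
          ← mul_assoc _ _ (∑ k : Fin (P.twoS + 1), Xk P k), hc]
        have hX := sum_Xk P
        generalize ∑ k : Fin (P.twoS + 1), Xk P k = SX at *
        have hX' : SX = (P.v ^ 2 + (P.v ^ 2)⁻¹) * ((P.q ^ P.twoS * P.q) ^ 2 - 1)
            / (P.q ^ P.twoS * (P.q ^ 2 - 1)) / (P.q + P.q⁻¹) := by
          rw [← hX, mul_div_cancel_left₀ _ hs]
        have hqi : P.q - P.q⁻¹ = (P.q ^ 2 - 1) / P.q := by field_simp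
        rw [sum_q_sq_pow, sum_q_sq_inv_pow, eigD, eigSp, eigInh, qNumber, hX', zpow_sub₀ hq,
          zpow_add₀ hq, zpow_neg, zpow_natCast, mul_comm 2 (P.twoS : ℤ), zpow_mul, zpow_natCast]
        simp only [gCoeff, Int.reduceSub, Int.reduceNeg, opConst, fCoeff, Complex.exp_neg, hs', hqi,
          pow_succ _ P.twoS]
        norm_cast
        have hy : P.q ^ P.twoS ≠ 0 := pow_ne_zero _ hq
        generalize P.q ^ P.twoS = y at *
        generalize Complex.exp P.muP = E at *
        generalize Complex.cosh P.mu = m at *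
        generalize P.qNu = N at *
        field_simp
        ring)
  rwa [hκ] at hop

/-! ### Nonvanishing of `Q` and assembly -/

theorem bigZ_ne_C (P : Params) (u : ℂ) : bigZ P ≠ RatFunc.C u := by
  intro h
  have hs := ratFuncC_q_add_inv_ne P
  have hz := (den_ne P).2.1
  rw [bigZ_eq_zAt, zAt, div_eq_iff hs] at h
  -- Clearing `z` from `Z = u` gives a polynomial relation whose constant coefficient is `1`, which
  -- is impossible.
  have h1 : algebraMap ℂ[X] (RatFunc ℂ) (X ^ 2 + 1 - C (u * (P.q + P.q⁻¹)) * X) = 0 := by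
    simp only [map_sub, map_add, map_mul, map_pow, map_one, RatFunc.algebraMap_X,
      RatFunc.algebraMap_C, map_inv₀]
    field_simp at h ⊢
    linear_combination h
  have h2 := (map_eq_zero_iff _ (RatFunc.algebraMap_injective ℂ)).1 h1
  have h3 := congrArg (fun p : ℂ[X] => p.coeff 0) h2
  simp at h3

theorem qFun_ne_zero (P : Params) {M : ℕ} (U : Fin M → ℂ) : qFun P U ≠ 0 :=
  Finset.prod_ne_zero_iff.2 fun j _ => sub_ne_zero.2 (bigZ_ne_C P (U j))

theorem piRep_heunAW_apply (P : Params) (κ κs : ℂ) (f : RatFunc ℂ) :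
    piRep P (heunAW P κ κs 0 0) f = κs • opAStar P f + κ • opA P f := by
  simp [heunAW, piRep_genA, piRep_genAStar, add_comm]

end

end HeunAW

theorem lemma4p5 (P : HeunAW.Params) :
    (∀ (κs : ℂ) (M : ℕ) (U : Fin M → ℂ), HeunAW.IsBetheSp P U →
      HeunAW.qFun P U ≠ 0 ∧
      HeunAW.piRep P (HeunAW.heunAW P 0 κs 0 0) (HeunAW.qFun P U) =
        HeunAW.eigSp P κs M • HeunAW.qFun P U) ∧
    (∀ (κ : ℂ) (U : Fin P.twoS → ℂ), HeunAW.IsBetheD P κ 0 U →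
      HeunAW.piRep P (HeunAW.heunAW P κ 0 0 0) (HeunAW.qFun P U) =
        HeunAW.eigInh P κ U • HeunAW.qFun P U
          - (κ * P.q * HeunAW.deltaD P
              * ((-1) ^ (P.twoS + 1) / (P.q + P.q⁻¹) ^ P.twoS)) • HeunAW.hFun P) ∧
    (∀ (κ κs : ℂ) (U : Fin P.twoS → ℂ), HeunAW.IsBetheD P κ κs U →
      HeunAW.piRep P (HeunAW.heunAW P κ κs 0 0) (HeunAW.qFun P U) =
        HeunAW.eigD P κ κs U • HeunAW.qFun P U
          - (κ * P.q * HeunAW.deltaD P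
              * ((-1) ^ (P.twoS + 1) / (P.q + P.q⁻¹) ^ P.twoS)) • HeunAW.hFun P) := by
  have hD : ∀ (κ κs : ℂ) (U : Fin P.twoS → ℂ), HeunAW.IsBetheD P κ κs U →
      HeunAW.piRep P (HeunAW.heunAW P κ κs 0 0) (HeunAW.qFun P U) =
        HeunAW.eigD P κ κs U • HeunAW.qFun P U
          - (κ * P.q * HeunAW.deltaD P
              * ((-1) ^ (P.twoS + 1) / (P.q + P.q⁻¹) ^ P.twoS)) • HeunAW.hFun P :=
    fun κ κs U h => (HeunAW.piRep_heunAW_apply P κ κs _).trans (HeunAW.opD_qFun P κ κs U h)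
  refine ⟨fun κs M U h => ⟨HeunAW.qFun_ne_zero P U, ?_⟩, fun κ U h => ?_, hD⟩
  · rw [HeunAW.piRep_heunAW_apply, zero_smul, add_zero, HeunAW.opAStar_qFun P U h, smul_smul]
    congr 1
    simp only [HeunAW.eigSp]
    ring
  -- Part 2 is part 3 at `κ* = 0`, where the `A*` contribution to the eigenvalue vanishes.
  · have h0 : HeunAW.eigD P κ 0 U = HeunAW.eigInh P κ U := by
      simp [HeunAW.eigD, HeunAW.eigSp]
    rw [hD κ 0 U h, h0]
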